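/- Let $I=[0,1]$. For $r\ge 1$ let $\mathrm{Diff}_+^r(I)$ be the set of $C^r$ diffeomorphisms of $I$ fixing $0$ and $1$; give $\mathrm{Diff}_+^1(I)$ the $C^1$ topology. Let $C_0(I)$ be the space of continuous $x:I\to\mathbf R$ with $x(0)=0$ and the sup norm, let $w$ be Wiener measure on the Borel sets of $C_0(I)$, and let $\nu(X)=w(A(X))$ be the measure on the Borel sets of $\mathrm{Diff}_+^1(I)$ induced by the homeomorphism $A:\mathrm{Diff}_+^1(I)\to C_0(I)$, $A(q)(t)=\log q'(t)-\log q'(0)$. Let $0<\delta<\frac12$, let $E_\delta\subseteq\mathrm{Diff}_+^1(I)$ be the set of those $q$ whose derivative is $\delta$-Hölder on $I$, and let $\nu_n=\nu\otimes\cdots\otimes\nu$ be the product measure on $E_\delta^n$. Put $M_l=\int_{E_\delta}(q'(1))^l\,\nu(dq)$ and $$c_4=1+M_1+M_2+\int_{E_\delta}\int_0^1 (q'(t))^2\,dt\,\nu(dq).$$ For $g\in\mathrm{Diff}_+^3(I)$ put $$S_g=\frac{g'''}{g'}-\frac32\left(\frac{g''}{g'}\right)^2,\qquad C_g=1+\max_{0\le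 t\le1}\left(\left|\frac{g''(t)}{g'(t)}\right|+\left|\left(\frac{g''(t)}{g'(t)}\right)^2\right|+\left|\frac{g'''(t)}{g'(t)}\right|\right).$$ Let $D_n=\{(x_1,\dots,x_{n-1}) : 0<x_1<\cdots<x_{n-1}<1\}$, with the conventions $x_0=0$, $x_n=1$, and $\|\mathbf x\|=\max_{1\le k\le n}(x_k-x_{k-1})$ for $\mathbf x\in D_n$. For $\mathbf x\in D_n$ and $\mathbf q=(q_1,\dots,q_n)\in E_\delta^n$ let $f_1(\mathbf q)=\sum_{k=1}^n X_k(\mathbf q)$ and $f_2(\mathbf q)=\sum_{k=1}^n Y_k(\mathbf q)$, where $$X_k(\mathbf q)=(x_k-x_{k-1})\left(\frac{g''(x_{k-1})}{g'(x_{k-1})}q_k'(0)-\frac{g''(x_k)}{g'(x_k)}q_k'(1)\right),$$ $$Y_k(\mathbf q)=(x_k-x_{k-1})^2\int_0^1 S_g\big(x_{k-1}+(x_k-x_{k-1})q_k(t)\big)\,(q_k'(t))^2\,dt.$$ **Lemma.** Let $0<\delta<\frac12$, $\varepsilon\in(0,1)$, $g\in\mathrm{Diff}_+^3(I)$ and $\mathbf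 x\in D_n$ with $\|\mathbf x\|<\varepsilon$. Then $\nu_n$ is a probability measure on $E_\delta^n$, $f_1+f_2$ is a (measurable) random variable on it, and $$\nu_n\Big(|f_1+f_2|>4c_4C_g\sqrt[3]{\varepsilon}\Big)\le 2\sqrt[3]{\varepsilon}.$$ -/

import Mathlib

open MeasureTheory ProbabilityTheory Filter Topology unitInterval
open scoped ContinuousMapZero

namespace WienerDiff

/-- The tent function with peak `1/2` at `1/2`, zero outside `[0, 1]`. -/
noncomputable def tent (y : ℝ) : ℝ := max 0 (min y (1 - y))

/-- The covariance of the Brownian bridge on `[0, 1]`, zero outside `[0, 1]`. -/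
noncomputable def bridgeCov (s t : ℝ) : ℝ :=
  min (max 0 (min s 1)) (max 0 (min t 1)) - max 0 (min s 1) * max 0 (min t 1)

theorem bridgeCov_rec (s t : ℝ) : bridgeCov s t = tent s * tent t +
    (bridgeCov (2 * s) (2 * t) + bridgeCov (2 * s - 1) (2 * t - 1)) / 2 := by
  have c0 : ∀ y : ℝ, y ≤ 0 → max 0 (min y 1) = 0 := by grind
  have c1 : ∀ y : ℝ, 0 ≤ y → y ≤ 1 → max 0 (min y 1) = y := by grind
  have c2 : ∀ y : ℝ, 1 ≤ y → max 0 (min y 1) = 1 := by grind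
  have key : ∀ y : ℝ, (y ≤ 0 ∧ tent y = 0 ∧ max 0 (min y 1) = 0 ∧ max 0 (min (2 * y) 1) = 0 ∧
        max 0 (min (2 * y - 1) 1) = 0) ∨
      ((0 ≤ y ∧ y ≤ 1 / 2) ∧ tent y = y ∧ max 0 (min y 1) = y ∧ max 0 (min (2 * y) 1) = 2 * y ∧
        max 0 (min (2 * y - 1) 1) = 0) ∨
      ((1 / 2 ≤ y ∧ y ≤ 1) ∧ tent y = 1 - y ∧ max 0 (min y 1) = y ∧ max 0 (min (2 * y) 1) = 1 ∧
        max 0 (min (2 * y - 1) 1) = 2 * y - 1) ∨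
      (1 ≤ y ∧ tent y = 0 ∧ max 0 (min y 1) = 1 ∧ max 0 (min (2 * y) 1) = 1 ∧
        max 0 (min (2 * y - 1) 1) = 1) := by
    intro y
    unfold tent
    rcases le_total y 0 with h | h
    · refine Or.inl ⟨h, ?_, c0 _ h, c0 _ (by linarith), c0 _ (by linarith)⟩
      grind
    rcases le_total y (1 / 2) with h' | h'
    · refine Or.inr (Or.inl ⟨⟨h, h'⟩, ?_, c1 _ h (by linarith), c1 _ (by linarith) (by linarith),
        c0 _ (by linarith)⟩)
      rw [min_eq_left (by linarith), max_eq_right h]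
    rcases le_total y 1 with h1 | h1
    · refine Or.inr (Or.inr (Or.inl ⟨⟨h', h1⟩, ?_, c1 _ h h1, c2 _ (by linarith),
        c1 _ (by linarith) (by linarith)⟩))
      rw [min_eq_right (by linarith), max_eq_right (by linarith)]
    · refine Or.inr (Or.inr (Or.inr ⟨h1, ?_, c2 _ h1, c2 _ (by linarith), c2 _ (by linarith)⟩))
      rw [min_eq_right (by linarith), max_eq_left (by linarith)]
  unfold bridgeCov
  rcases key s with ⟨h1, h2, h3, h4, h5⟩ | ⟨⟨h0, h1⟩, h2, h3, h4, h5⟩ |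
    ⟨⟨h0, h1⟩, h2, h3, h4, h5⟩ | ⟨h1, h2, h3, h4, h5⟩ <;>
  rcases key t with ⟨k1, k2, k3, k4, k5⟩ | ⟨⟨k0, k1⟩, k2, k3, k4, k5⟩ |
    ⟨⟨k0, k1⟩, k2, k3, k4, k5⟩ | ⟨k1, k2, k3, k4, k5⟩ <;>
  rw [h2, h3, h4, h5, k2, k3, k4, k5] <;>
  simp only [min_def] <;> split_ifs <;>
  first | (exfalso; linarith) | ring1 | nlinarith

theorem sum_range_two_mul (f : ℕ → ℝ) (m : ℕ) :
    ∑ i ∈ Finset.range (2 * m), f i = ∑ j ∈ Finset.range m, (f (2 * j) + f (2 * j + 1)) := by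
  induction m with
  | zero => simp
  | succ m ih =>
    rw [Finset.sum_range_succ, ← ih, show 2 * (m + 1) = 2 * m + 1 + 1 by ring,
      Finset.sum_range_succ, Finset.sum_range_succ]
    ring

theorem bridgeCov_iter (s t : ℝ) (N : ℕ) : bridgeCov s t =
    ∑ n ∈ Finset.range N, (1 / 2 : ℝ) ^ n *
      ∑ j ∈ Finset.range (2 ^ n), tent (2 ^ n * s - j) * tent (2 ^ n * t - j) +
    (1 / 2 : ℝ) ^ N * ∑ j ∈ Finset.range (2 ^ N), bridgeCov (2 ^ N * s - j) (2 ^ N * t - j) := by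
  induction N with
  | zero => simp
  | succ N ih =>
    rw [ih, Finset.sum_range_succ, add_assoc]
    congr 1
    have h : ∑ i ∈ Finset.range (2 ^ (N + 1)),
        bridgeCov (2 ^ (N + 1) * s - i) (2 ^ (N + 1) * t - i) =
        ∑ j ∈ Finset.range (2 ^ N),
          (bridgeCov (2 * (2 ^ N * s - j)) (2 * (2 ^ N * t - j)) +
          bridgeCov (2 * (2 ^ N * s - j) - 1) (2 * (2 ^ N * t - j) - 1)) := by
      have e : (2 : ℕ) ^ (N + 1) = 2 * 2 ^ N := by ring
      rw [e, sum_range_two_mul]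
      refine Finset.sum_congr rfl fun j _ => ?_
      push_cast
      congr 2 <;> ring
    rw [h, Finset.sum_congr rfl fun (j : ℕ) _ => bridgeCov_rec (2 ^ N * s - j) (2 ^ N * t - j),
      Finset.sum_add_distrib, mul_add, ← Finset.sum_div, pow_succ]
    ring

theorem abs_sum_le_of_local (f : ℕ → ℝ) (y b : ℝ) (hb : 0 ≤ b) (M : ℕ)
    (h : ∀ j, f j ≠ 0 → 0 < y - j ∧ y - j < 1) (hf : ∀ j, |f j| ≤ b) :
    |∑ j ∈ Finset.range M, f j| ≤ b := by
  by_cases h0 : ∀ j ∈ Finset.range M, f j = 0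
  · rw [Finset.sum_eq_zero h0]; simpa
  · push Not at h0
    obtain ⟨i, hi, hi0⟩ := h0
    rw [Finset.sum_eq_single_of_mem i hi]
    · exact hf i
    · intro j _ hji
      by_contra hj
      apply hji
      have h1 := h i hi0
      have h2 := h j hj
      have h3 : (j : ℝ) < i + 1 := by linarith
      have h4 : (i : ℝ) < j + 1 := by linarith
      norm_cast at h3 h4
      omega

theorem tent_local {y : ℝ} (h : tent y ≠ 0) : 0 < y ∧ y < 1 := by
  unfold tent at h; grind

theorem abs_tent_le (y : ℝ) : |tent y| ≤ 1 := by
  unfold tent; rw [abs_le]; grind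

theorem bridgeCov_local {y z : ℝ} (h : bridgeCov y z ≠ 0) : 0 < y ∧ y < 1 := by
  by_contra h'
  apply h
  unfold bridgeCov
  rcases le_or_gt y 0 with h0 | h0
  · have : max 0 (min y 1) = 0 := by grind
    rw [this]; grind
  · have : max 0 (min y 1) = 1 := by grind
    rw [this]; grind

theorem abs_bridgeCov_le (y z : ℝ) : |bridgeCov y z| ≤ 1 := by
  unfold bridgeCov
  have h1 : 0 ≤ max 0 (min y 1) ∧ max 0 (min y 1) ≤ 1 := by grind
  have h2 : 0 ≤ max 0 (min z 1) ∧ max 0 (min z 1) ≤ 1 := by grind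
  generalize max 0 (min y 1) = a at *
  generalize max 0 (min z 1) = b at *
  rw [abs_le]
  rcases le_total a b with h | h
  · rw [min_eq_left h]; constructor <;> nlinarith
  · rw [min_eq_right h]; constructor <;> nlinarith

/-- The Schauder function of level `n` and position `j`, carried from the Brownian bridge to the
Brownian motion by `t ↦ (1 + t) * b (t / (1 + t))`. -/
noncomputable def schauder (n j : ℕ) : C(I, ℝ)₀ where
  toFun t := (1 + (t : ℝ)) * ((√2)⁻¹ ^ n * tent (2 ^ n * ((t : ℝ) / (1 + t)) - j))
  continuous_toFun := by
    unfold tent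
    have : ∀ t : I, (1 + (t : ℝ)) ≠ 0 := fun t => by have := t.2.1; positivity
    fun_prop (disch := assumption)
  map_zero' := by
    simp [tent]

theorem schauder_apply (n j : ℕ) (t : I) : schauder n j t =
    (1 + (t : ℝ)) * ((√2)⁻¹ ^ n * tent (2 ^ n * ((t : ℝ) / (1 + t)) - j)) := rfl

theorem min_eq_bridgeCov (s t : I) : min (s : ℝ) t =
    (1 + (s : ℝ)) * (1 + (t : ℝ)) * bridgeCov (s / (1 + s)) (t / (1 + t)) := by
  have hc : ∀ t : I, max 0 (min ((t : ℝ) / (1 + t)) 1) = t / (1 + t) := by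
    intro t
    have := t.2.1
    rw [min_eq_left, max_eq_right]
    · positivity
    · rw [div_le_one (by positivity)]; linarith
  unfold bridgeCov
  rw [hc, hc]
  have hs := s.2.1
  have ht := t.2.1
  rcases le_total (s : ℝ) t with h | h
  · rw [min_eq_left h, min_eq_left]
    · field_simp; ring
    · rw [div_le_div_iff₀ (by positivity) (by positivity)]; linarith
  · rw [min_eq_right h, min_eq_right]
    · field_simp; ring
    · rw [div_le_div_iff₀ (by positivity) (by positivity)]; linarith

theorem tendsto_schauder_cov (s t : I) : Tendsto (fun N : ℕ => ∑ n ∈ Finset.range N,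
    ∑ j ∈ Finset.range (2 ^ n), schauder n j s * schauder n j t) atTop (𝓝 (min (s : ℝ) t)) := by
  set u : ℝ := s / (1 + s)
  set v : ℝ := t / (1 + t)
  set R : ℕ → ℝ := fun N => ∑ j ∈ Finset.range (2 ^ N), bridgeCov (2 ^ N * u - j) (2 ^ N * v - j)
  have hR : ∀ N, |R N| ≤ 1 := fun N => abs_sum_le_of_local _ (2 ^ N * u) 1 zero_le_one _
    (fun j hj => bridgeCov_local hj) (fun j => abs_bridgeCov_le _ _)
  have h1 : Tendsto (fun N : ℕ => (1 / 2 : ℝ) ^ N * R N) atTop (𝓝 0) := by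
    refine squeeze_zero_norm (a := fun N => (1 / 2 : ℝ) ^ N) (fun N => ?_)
      (tendsto_pow_atTop_nhds_zero_of_lt_one (by norm_num) (by norm_num))
    rw [norm_mul, Real.norm_eq_abs, Real.norm_eq_abs, abs_of_nonneg (by positivity)]
    exact mul_le_of_le_one_right (by positivity) (hR N)
  have h2 : (fun N : ℕ => ∑ n ∈ Finset.range N,
      ∑ j ∈ Finset.range (2 ^ n), schauder n j s * schauder n j t) =
      fun N => min (s : ℝ) t - (1 + (s : ℝ)) * (1 + (t : ℝ)) * ((1 / 2 : ℝ) ^ N * R N) := by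
    funext N
    rw [min_eq_bridgeCov, bridgeCov_iter u v N, mul_add, add_sub_cancel_right, Finset.mul_sum]
    refine Finset.sum_congr rfl fun n _ => ?_
    rw [Finset.mul_sum, Finset.mul_sum]
    refine Finset.sum_congr rfl fun j _ => ?_
    rw [schauder_apply, schauder_apply]
    have : (√2)⁻¹ ^ n * (√2)⁻¹ ^ n = (1 / 2 : ℝ) ^ n := by
      rw [← mul_pow, ← mul_inv, Real.mul_self_sqrt (by norm_num)]; norm_num
    rw [← this]
    ring
  rw [h2]
  simpa using tendsto_const_nhds.sub (h1.const_mul ((1 + (s : ℝ)) * (1 + (t : ℝ))))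

theorem schauder_zero_outside {n j : ℕ} {t : I} (h : schauder n j t ≠ 0) :
    0 < 2 ^ n * ((t : ℝ) / (1 + t)) - j ∧ 2 ^ n * ((t : ℝ) / (1 + t)) - j < 1 := by
  rw [schauder_apply] at h
  exact tent_local fun h0 => h (by rw [h0]; simp)

theorem abs_schauder_le (n j : ℕ) (t : I) : |schauder n j t| ≤ 2 * (√2)⁻¹ ^ n := by
  rw [schauder_apply, abs_mul, abs_mul, abs_of_nonneg (a := (√2)⁻¹ ^ n) (by positivity),
    abs_of_nonneg (a := 1 + (t : ℝ)) (by have := t.2.1; positivity)]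
  have h1 := abs_tent_le (2 ^ n * ((t : ℝ) / (1 + t)) - j)
  have h2 := t.2.2
  have h3 := t.2.1
  have h4 : 0 ≤ (√2)⁻¹ ^ n := by positivity
  calc _ ≤ 2 * ((√2)⁻¹ ^ n * 1) := by gcongr; linarith
    _ = _ := by ring

/-- The sum of the Schauder functions of level `n` with coefficients `ω`. -/
noncomputable def level (ω : (Σ _ : ℕ, ℕ) → ℝ) (n : ℕ) : C(I, ℝ)₀ :=
  ∑ j ∈ Finset.range (2 ^ n), ω ⟨n, j⟩ • schauder n j

theorem coe_sum_apply {ι : Type*} (s : Finset ι) (f : ι → C(I, ℝ)₀) (t : I) :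
    (∑ i ∈ s, f i) t = ∑ i ∈ s, f i t :=
  map_sum (ContinuousMapZero.evalCLM ℝ t) f s

theorem norm_level_le (ω : (Σ _ : ℕ, ℕ) → ℝ) (n : ℕ) (b : ℝ) (hb : 0 ≤ b)
    (h : ∀ j < 2 ^ n, |ω ⟨n, j⟩| ≤ b) : ‖level ω n‖ ≤ 2 * b * (√2)⁻¹ ^ n := by
  rw [ContinuousMapZero.norm_def, ContinuousMap.norm_le _ (by positivity)]
  intro t
  change |level ω n t| ≤ _
  unfold level
  rw [coe_sum_apply]
  have e : ∀ j ∈ Finset.range (2 ^ n), (ω ⟨n, j⟩ • schauder n j) t =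
      if j < 2 ^ n then ω ⟨n, j⟩ * schauder n j t else 0 := by
    intro j hj
    rw [if_pos (Finset.mem_range.1 hj)]
    rfl
  rw [Finset.sum_congr rfl e]
  refine abs_sum_le_of_local _ (2 ^ n * ((t : ℝ) / (1 + t))) _ (by positivity) _ ?_ ?_
  · intro j hj
    split_ifs at hj with hjn
    · exact schauder_zero_outside (right_ne_zero_of_mul hj)
    · exact absurd rfl hj
  · intro j
    split_ifs with hjn
    · rw [abs_mul]
      calc _ ≤ b * (2 * (√2)⁻¹ ^ n) := by
            gcongr
            · exact h j hjn
            · exact abs_schauder_le n j t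
        _ = _ := by ring
    · simp; positivity

/-- A countable family of independent standard Gaussian variables. -/
noncomputable def gaussSeq : Measure ((Σ _ : ℕ, ℕ) → ℝ) :=
  Measure.infinitePi fun _ => gaussianReal 0 1

instance : IsProbabilityMeasure gaussSeq := by unfold gaussSeq; infer_instance

theorem ae_coeff_bound : ∀ᵐ ω ∂gaussSeq, ∃ K : ℝ, 0 ≤ K ∧
    ∀ n, ∀ j < 2 ^ n, |ω ⟨n, j⟩| ≤ K * (4 / 3) ^ n := by
  set F : (Σ _ : ℕ, ℕ) → ((Σ _ : ℕ, ℕ) → ℝ) → ENNReal := fun p ω =>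
    if p.2 < 2 ^ p.1 then ‖ω p / (4 / 3) ^ p.1‖ₑ ^ 8 else 0 with hF
  have hmeas : ∀ p, Measurable (F p) := by
    intro p
    simp only [hF]
    split_ifs <;> fun_prop
  set m : ENNReal := ∫⁻ x, ‖x‖ₑ ^ 8 ∂gaussianReal 0 1 with hm
  have hmtop : m ≠ ⊤ := by
    have h := (memLp_id_gaussianReal (μ := 0) (v := 1) 8).eLpNorm_lt_top
    rw [eLpNorm_lt_top_iff_lintegral_rpow_enorm_lt_top (by norm_num) (by norm_num)] at h
    refine ne_of_lt (lt_of_le_of_lt (le_of_eq ?_) h)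
    rw [hm]
    refine lintegral_congr fun x => ?_
    simp only [id, ENNReal.coe_ofNat, ENNReal.toReal_ofNat]
    exact_mod_cast (ENNReal.rpow_natCast ‖x‖ₑ 8).symm
  have hint : ∀ p, ∫⁻ ω, F p ω ∂gaussSeq ≤
      if p.2 < 2 ^ p.1 then ENNReal.ofReal (((3 / 4) ^ 8) ^ p.1) * m else 0 := by
    intro p
    simp only [hF]
    split_ifs with hp
    · have e : ∀ x : ℝ, ‖x / (4 / 3) ^ p.1‖ₑ ^ 8 =
          ENNReal.ofReal (((3 / 4) ^ 8) ^ p.1) * ‖x‖ₑ ^ 8 := by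
        intro x
        rw [div_eq_inv_mul, enorm_mul, mul_pow]
        congr 1
        rw [Real.enorm_of_nonneg (by positivity), ← ENNReal.ofReal_pow (by positivity)]
        congr 1
        rw [← inv_pow, ← pow_mul, ← pow_mul, mul_comm]
        norm_num
      have hmap : gaussSeq.map (fun ω => ω p) = gaussianReal 0 1 :=
        Measure.infinitePi_map_eval _ p
      simp_rw [e]
      rw [lintegral_const_mul _ (by fun_prop), hm, ← hmap,
        lintegral_map (by fun_prop) (by fun_prop)]
    · simp
  have hsum : ∫⁻ ω, ∑' p, F p ω ∂gaussSeq ≠ ⊤ := by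
    rw [lintegral_tsum fun p => (hmeas p).aemeasurable]
    refine ne_top_of_le_ne_top ?_ (ENNReal.tsum_le_tsum hint)
    rw [ENNReal.tsum_sigma']
    have h1 : ∀ n : ℕ, ∑' j : ℕ, (if j < 2 ^ n then ENNReal.ofReal (((3 / 4) ^ 8) ^ n) * m else 0) =
        ENNReal.ofReal ((2 * (3 / 4) ^ 8) ^ n) * m := by
      intro n
      rw [tsum_eq_sum (s := Finset.range (2 ^ n))
        (fun j hj => if_neg (by simpa using hj)),
        Finset.sum_congr rfl fun j hj => if_pos (Finset.mem_range.1 hj),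
        Finset.sum_const, Finset.card_range, nsmul_eq_mul, ← mul_assoc]
      congr 1
      rw [mul_pow, ENNReal.ofReal_mul (by positivity)]
      congr 1
      rw [ENNReal.ofReal_pow (by norm_num)]
      norm_num
    simp only [h1]
    rw [ENNReal.tsum_mul_right]
    refine ENNReal.mul_ne_top ?_ hmtop
    rw [← ENNReal.ofReal_tsum_of_nonneg (fun n => by positivity)
      (summable_geometric_of_lt_one (by norm_num) (by norm_num))]
    exact ENNReal.ofReal_ne_top
  filter_upwards [ae_lt_top (Measurable.tsum hmeas) hsum] with ω hω
  refine ⟨1 + (∑' p, F p ω).toReal, by positivity, fun n j hj => ?_⟩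
  have h1 : F ⟨n, j⟩ ω ≤ ∑' p, F p ω := ENNReal.le_tsum _
  have h2 : ‖ω ⟨n, j⟩ / (4 / 3) ^ n‖ ^ 8 ≤ (∑' p, F p ω).toReal := by
    have h3 := ENNReal.toReal_mono hω.ne h1
    simp only [hF, if_pos hj, ENNReal.toReal_pow, toReal_enorm] at h3
    exact h3
  have h4 : ‖ω ⟨n, j⟩ / (4 / 3) ^ n‖ ≤ 1 + (∑' p, F p ω).toReal := by
    by_contra hc
    push Not at hc
    have h0 : 0 ≤ (∑' p, F p ω).toReal := ENNReal.toReal_nonneg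
    have h5 : ‖ω ⟨n, j⟩ / (4 / 3) ^ n‖ ≤ ‖ω ⟨n, j⟩ / (4 / 3) ^ n‖ ^ 8 :=
      le_self_pow₀ (by linarith) (by norm_num)
    linarith
  rw [norm_div, Real.norm_eq_abs, Real.norm_of_nonneg (by positivity),
    div_le_iff₀ (by positivity)] at h4
  exact h4

/-- The random path with Schauder coefficients `ω`. -/
noncomputable def path (ω : (Σ _ : ℕ, ℕ) → ℝ) : C(I, ℝ)₀ := ∑' n, level ω n

theorem ae_tendsto_path : ∀ᵐ ω ∂gaussSeq,
    Tendsto (fun N => ∑ n ∈ Finset.range N, level ω n) atTop (𝓝 (path ω)) := by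
  filter_upwards [ae_coeff_bound] with ω ⟨K, hK, h⟩
  refine HasSum.tendsto_sum_nat (Summable.hasSum ?_)
  have hr : (4 / 3 : ℝ) * (√2)⁻¹ < 1 := by
    rw [← div_eq_mul_inv, div_lt_one (by positivity)]
    exact Real.lt_sqrt_of_sq_lt (by norm_num)
  refine Summable.of_norm_bounded (g := fun n => 2 * K * (4 / 3 * (√2)⁻¹) ^ n)
    ((summable_geometric_of_lt_one (by positivity) hr).mul_left _) fun n => ?_
  refine (norm_level_le ω n (K * (4 / 3) ^ n) (by positivity) (h n)).trans (le_of_eq ?_)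
  rw [mul_pow]; ring

/-- The Borel sets of the space of continuous paths starting at `0`. -/
instance : MeasurableSpace C(I, ℝ)₀ := borel _

instance : BorelSpace C(I, ℝ)₀ := ⟨rfl⟩

theorem aemeasurable_path : AEMeasurable path gaussSeq := by
  refine AEStronglyMeasurable.aemeasurable ?_
  refine aestronglyMeasurable_of_tendsto_ae atTop
    (f := fun N ω => ∑ n ∈ Finset.range N, level ω n) (fun N => ?_) ae_tendsto_path
  refine StronglyMeasurable.aestronglyMeasurable ?_
  unfold level
  refine Finset.stronglyMeasurable_fun_sum _ fun n _ => ?_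
  refine Finset.stronglyMeasurable_fun_sum _ fun j _ => ?_
  exact ((measurable_pi_apply _).stronglyMeasurable).smul_const _

theorem integral_exp_gaussSeq (s : Finset (Σ _ : ℕ, ℕ)) (a : (Σ _ : ℕ, ℕ) → ℝ) :
    ∫ ω, Complex.exp (((∑ p ∈ s, a p * ω p : ℝ) : ℂ) * Complex.I) ∂gaussSeq =
      Complex.exp (((-(∑ p ∈ s, a p ^ 2) / 2 : ℝ) : ℂ)) := by
  have hi : iIndepFun (fun p (ω : (Σ _ : ℕ, ℕ) → ℝ) => a p * ω p) gaussSeq :=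
    iIndepFun_infinitePi (X := fun p x => a p * x) (fun p => by fun_prop)
  have h := congrFun ((hi.restrict s).charFun_map_fun_finsetSum_eq_prod
    (X := fun p (ω : (Σ _ : ℕ, ℕ) → ℝ) => a p * ω p)
    (fun p _ => Measurable.aemeasurable (by fun_prop))) 1
  have hmap : ∀ p, gaussSeq.map (fun ω => a p * ω p) =
      gaussianReal 0 (Real.toNNReal (a p ^ 2)) := by
    intro p
    have h1 : gaussSeq.map (fun ω => ω p) = gaussianReal 0 1 := Measure.infinitePi_map_eval _ p
    have h2 := gaussianReal_map_const_mul (μ := 0) (v := 1) (a p)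
    rw [← h1, Measure.map_map (by fun_prop) (by fun_prop), mul_zero, mul_one] at h2
    rw [Real.toNNReal_of_nonneg (sq_nonneg _)]
    exact h2
  rw [charFun_apply_real, integral_map (Measurable.aemeasurable (by fun_prop)) (by fun_prop)] at h
  simp only [Complex.ofReal_one, one_mul] at h
  rw [h, Finset.prod_apply, Finset.prod_congr rfl fun p _ => by
    rw [hmap p, charFun_gaussianReal], ← Complex.exp_sum]
  congr 1
  push_cast
  rw [neg_div, Finset.sum_div, ← Finset.sum_neg_distrib]
  refine Finset.sum_congr rfl fun p _ => ?_
  rw [Real.coe_toNNReal _ (sq_nonneg _)]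
  simp

theorem increment_cov {m : ℕ} (t : Fin (m + 1) → I) (ht : Monotone t) (i j : Fin m) :
    min (t i.succ : ℝ) (t j.succ) - min (t i.succ : ℝ) (t j.castSucc) -
      min (t i.castSucc : ℝ) (t j.succ) + min (t i.castSucc : ℝ) (t j.castSucc) =
    if i = j then (t i.succ : ℝ) - t i.castSucc else 0 := by
  have mono : ∀ a b : Fin (m + 1), a ≤ b → (t a : ℝ) ≤ t b := fun a b h => ht h
  have hi := mono _ _ (Fin.castSucc_lt_succ (i := i)).le
  have hj := mono _ _ (Fin.castSucc_lt_succ (i := j)).le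
  split_ifs with hij
  · subst hij
    rw [min_self, min_eq_right hi, min_eq_left hi, min_self]; ring
  · rcases lt_or_gt_of_ne hij with h | h
    · have h1 := mono i.succ j.castSucc (by rw [Fin.le_def]; simpa using h)
      rw [min_eq_left (h1.trans hj), min_eq_left h1, min_eq_left (hi.trans (h1.trans hj)),
        min_eq_left (hi.trans h1)]; ring
    · have h1 := mono j.succ i.castSucc (by rw [Fin.le_def]; simpa using h)
      rw [min_eq_right (h1.trans hi), min_eq_right (hj.trans (h1.trans hi)), min_eq_right h1,
        min_eq_right (hj.trans h1)]; ring

theorem integral_exp_path {m : ℕ} (t : Fin (m + 1) → I) (ht : Monotone t) (b : Fin m → ℝ) :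
    ∫ ω, Complex.exp (((∑ i, b i * (path ω (t i.succ) - path ω (t i.castSucc)) : ℝ) : ℂ) *
      Complex.I) ∂gaussSeq =
    Complex.exp (((-(∑ i, b i ^ 2 * ((t i.succ : ℝ) - t i.castSucc)) / 2 : ℝ) : ℂ)) := by
  set d : C(I, ℝ)₀ → ℝ := fun x => ∑ i, b i * (x (t i.succ) - x (t i.castSucc)) with hd
  have hdc : Continuous d := by
    simp only [hd]
    fun_prop
  set idx : ℕ → Finset (Σ _ : ℕ, ℕ) := fun N =>
    (Finset.range N).sigma fun n => Finset.range (2 ^ n)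
  set S : ℕ → ((Σ _ : ℕ, ℕ) → ℝ) → C(I, ℝ)₀ := fun N ω => ∑ n ∈ Finset.range N, level ω n
  have hS : ∀ N ω, d (S N ω) = ∑ p ∈ idx N, d (schauder p.1 p.2) * ω p := by
    intro N ω
    have e : ∀ u : I, S N ω u = ∑ p ∈ idx N, ω p * schauder p.1 p.2 u := by
      intro u
      simp only [S, idx, level, coe_sum_apply, Finset.sum_sigma]
      rfl
    simp only [hd, e, ← Finset.sum_sub_distrib, Finset.mul_sum, Finset.sum_mul]
    rw [Finset.sum_comm]
    refine Finset.sum_congr rfl fun p _ => Finset.sum_congr rfl fun i _ => ?_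
    ring
  have hvar : Tendsto (fun N => ∑ p ∈ idx N, d (schauder p.1 p.2) ^ 2) atTop
      (𝓝 (∑ i, b i ^ 2 * ((t i.succ : ℝ) - t i.castSucc))) := by
    set C : ℕ → I → I → ℝ := fun N u v => ∑ n ∈ Finset.range N,
      ∑ j ∈ Finset.range (2 ^ n), schauder n j u * schauder n j v with hC
    have e : ∀ N, ∑ p ∈ idx N, d (schauder p.1 p.2) ^ 2 = ∑ i, ∑ j, b i * b j *
        (C N (t i.succ) (t j.succ) - C N (t i.succ) (t j.castSucc) -
        C N (t i.castSucc) (t j.succ) + C N (t i.castSucc) (t j.castSucc)) := by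
      intro N
      have hC' : ∀ u v, C N u v = ∑ p ∈ idx N, schauder p.1 p.2 u * schauder p.1 p.2 v := by
        intro u v
        simp only [hC, idx, Finset.sum_sigma]
      simp only [hC', ← Finset.sum_sub_distrib, ← Finset.sum_add_distrib, Finset.mul_sum]
      rw [Finset.sum_congr rfl fun i _ => Finset.sum_comm, Finset.sum_comm]
      refine Finset.sum_congr rfl fun p _ => ?_
      rw [sq, hd, Finset.sum_mul_sum]
      refine Finset.sum_congr rfl fun i _ => Finset.sum_congr rfl fun j _ => ?_
      ring
    simp only [e]
    have hlim : Tendsto (fun N => ∑ i, ∑ j, b i * b j *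
        (C N (t i.succ) (t j.succ) - C N (t i.succ) (t j.castSucc) -
        C N (t i.castSucc) (t j.succ) + C N (t i.castSucc) (t j.castSucc))) atTop
        (𝓝 (∑ i, ∑ j, b i * b j * (min (t i.succ : ℝ) (t j.succ) -
          min (t i.succ : ℝ) (t j.castSucc) -
          min (t i.castSucc : ℝ) (t j.succ) + min (t i.castSucc : ℝ) (t j.castSucc)))) := by
      refine tendsto_finsetSum _ fun i _ => tendsto_finsetSum _ fun j _ => ?_
      exact ((((tendsto_schauder_cov _ _).sub (tendsto_schauder_cov _ _)).sub
        (tendsto_schauder_cov _ _)).add (tendsto_schauder_cov _ _)).const_mul _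
    convert hlim using 2
    refine Finset.sum_congr rfl fun i _ => ?_
    simp only [increment_cov t ht]
    simp [sq]
  have hl : Tendsto (fun N => ∫ ω, Complex.exp (((d (S N ω) : ℝ) : ℂ) * Complex.I) ∂gaussSeq) atTop
      (𝓝 (∫ ω, Complex.exp (((d (path ω) : ℝ) : ℂ) * Complex.I) ∂gaussSeq)) := by
    refine tendsto_integral_of_dominated_convergence (fun _ => 1) ?_ (integrable_const _) ?_ ?_
    · intro N
      simp only [hS]
      exact Measurable.aestronglyMeasurable (by fun_prop)
    · intro N
      exact ae_of_all _ fun ω => by rw [Complex.norm_exp_ofReal_mul_I]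
    · filter_upwards [ae_tendsto_path] with ω hω
      have hc : Continuous fun x : C(I, ℝ)₀ => Complex.exp (((d x : ℝ) : ℂ) * Complex.I) := by
        fun_prop
      exact (hc.tendsto _).comp hω
  simp only [hS, integral_exp_gaussSeq] at hl
  have hr : Tendsto (fun N => Complex.exp
      (((-(∑ p ∈ idx N, d (schauder p.1 p.2) ^ 2) / 2 : ℝ) : ℂ))) atTop
      (𝓝 (Complex.exp (((-(∑ i, b i ^ 2 * ((t i.succ : ℝ) - t i.castSucc)) / 2 : ℝ) : ℂ)))) := by
    have hc : Continuous fun x : ℝ => Complex.exp (((-x / 2 : ℝ) : ℂ)) := by fun_prop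
    exact (hc.tendsto _).comp hvar
  exact tendsto_nhds_unique hl hr

/-- Wiener measure on the space of continuous paths `x` on `[0, 1]` with `x 0 = 0`: the Borel
probability measure under which the increments `x t - x s` over disjoint intervals are independent
and `x t - x s` is normal with mean `0` and variance `t - s`. -/
structure IsWienerMeasure (w : Measure C(I, ℝ)₀) : Prop where
  isProbabilityMeasure : IsProbabilityMeasure w
  map_increment : ∀ s t : I, s ≤ t →
    w.map (fun x => x t - x s) = gaussianReal 0 (Real.toNNReal ((t : ℝ) - s))
  hasIndepIncrements : HasIndepIncrements (fun (t : I) (x : C(I, ℝ)₀) => x t) w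

theorem exists_isWienerMeasure : ∃ w : Measure C(I, ℝ)₀, IsWienerMeasure w := by
  have hp : IsProbabilityMeasure (gaussSeq.map path) :=
    Measure.isProbabilityMeasure_map aemeasurable_path
  have hev : ∀ t : I, Measurable fun x : C(I, ℝ)₀ => x t := fun t =>
    (continuous_eval_const t).measurable
  have key : ∀ {m : ℕ} (t : Fin (m + 1) → I) (_ : Monotone t) (b : Fin m → ℝ),
      ∫ x, Complex.exp (((∑ i, b i * (x (t i.succ) - x (t i.castSucc)) : ℝ) : ℂ) *
        Complex.I) ∂(gaussSeq.map path) =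
      Complex.exp (((-(∑ i, b i ^ 2 * ((t i.succ : ℝ) - t i.castSucc)) / 2 : ℝ) : ℂ)) := by
    intro m t ht b
    rw [integral_map aemeasurable_path, integral_exp_path t ht b]
    refine Measurable.aestronglyMeasurable ?_
    fun_prop
  have hinc : ∀ s t : I, s ≤ t → (gaussSeq.map path).map (fun x => x t - x s) =
      gaussianReal 0 (Real.toNNReal ((t : ℝ) - s)) := by
    intro s t hst
    have : IsProbabilityMeasure ((gaussSeq.map path).map (fun x => x t - x s)) :=
      Measure.isProbabilityMeasure_map (by fun_prop)
    refine Measure.ext_of_charFun ?_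
    funext ξ
    rw [charFun_gaussianReal, charFun_apply_real, integral_map (by fun_prop) (by fun_prop)]
    have h := key (m := 1) ![s, t] (by
      intro i j hij
      fin_cases i <;> fin_cases j <;> simp_all) (fun _ => ξ)
    simp only [Finset.univ_unique, Fin.default_eq_zero, Finset.sum_singleton] at h
    have hst' : (0 : ℝ) ≤ t - s := sub_nonneg.2 hst
    refine Eq.trans (integral_congr_ae (ae_of_all _ fun x => ?_)) (h.trans ?_)
    · simp
    · rw [Real.coe_toNNReal _ hst']
      simp only [Complex.ofReal_div, Complex.ofReal_neg, Complex.ofReal_mul, Complex.ofReal_pow,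
        Complex.ofReal_sub, Complex.ofReal_ofNat, Complex.ofReal_zero, mul_zero, zero_mul, zero_sub]
      congr 1
      change -((ξ : ℂ) ^ 2 * ((t : ℝ) - (s : ℝ))) / 2 = _
      ring
  refine ⟨gaussSeq.map path, hp, hinc, fun m t ht => ?_⟩
  rw [iIndepFun_iff_charFun_pi (fun i => by fun_prop)]
  intro b
  rw [charFun_apply, integral_map (by fun_prop) (by fun_prop)]
  have hmono : ∀ i : Fin m, t i.castSucc ≤ t i.succ := fun i => ht Fin.castSucc_lt_succ.le
  rw [Finset.prod_congr rfl fun i _ => by rw [hinc _ _ (hmono i), charFun_gaussianReal],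
    ← Complex.exp_sum]
  refine Eq.trans (integral_congr_ae (ae_of_all _ fun x => ?_)) ((key t ht b).trans ?_)
  · simp [PiLp.inner_apply]
  · congr 1
    push_cast
    rw [neg_div, Finset.sum_div, ← Finset.sum_neg_distrib]
    refine Finset.sum_congr rfl fun i _ => ?_
    rw [Real.coe_toNNReal _ (sub_nonneg.2 (hmono i))]
    push_cast
    ring

/-- Wiener measure. -/
noncomputable def wienerMeasure : Measure C(I, ℝ)₀ := exists_isWienerMeasure.choose

theorem isWienerMeasure_wienerMeasure : IsWienerMeasure wienerMeasure :=
  exists_isWienerMeasure.choose_spec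

/-- A self-map of `[0, 1]`, read as a real function that is constant outside `[0, 1]`. -/
noncomputable def realFun (f : I ≃ₜ I) : ℝ → ℝ :=
  Set.IccExtend (zero_le_one' ℝ) fun t => (f t : ℝ)

/-- `Diff_+^r(I)`: the diffeomorphisms of class `C^r` of `[0, 1]` that fix `0` and `1`. -/
def DiffPlus (r : ℕ) : Type :=
  {f : I ≃ₜ I // ContDiffOn ℝ r (realFun f) (Set.Icc 0 1) ∧
    ContDiffOn ℝ r (realFun f.symm) (Set.Icc 0 1) ∧ f 0 = 0 ∧ f 1 = 1}

/-- The function `q : [0, 1] → [0, 1]`, as a function on `ℝ`. -/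
noncomputable def DiffPlus.fn {r : ℕ} (q : DiffPlus r) : ℝ → ℝ := realFun q.1

/-- The `k`-th derivative of `q` on `[0, 1]`, one-sided at the endpoints. -/
noncomputable def DiffPlus.der {r : ℕ} (q : DiffPlus r) (k : ℕ) (t : ℝ) : ℝ :=
  iteratedDerivWithin k q.fn (Set.Icc 0 1) t

theorem DiffPlus.continuous_der_one (q : DiffPlus 1) :
    Continuous fun t : I => q.der 1 t := by
  have h : ContinuousOn (q.der 1) (Set.Icc 0 1) :=
    q.2.1.continuousOn_iteratedDerivWithin le_rfl (uniqueDiffOn_Icc zero_lt_one)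
  exact h.comp_continuous continuous_subtype_val fun t => t.2

theorem DiffPlus.der_one_ne_zero (q : DiffPlus 1) (t : I) : q.der 1 t ≠ 0 := by
  have hU : UniqueDiffWithinAt ℝ (Set.Icc (0 : ℝ) 1) t := uniqueDiffOn_Icc zero_lt_one t t.2
  have hval : ∀ (f : I ≃ₜ I) (s : I), realFun f s = f s := fun f s =>
    Set.IccExtend_val _ _ s
  have h1 : HasDerivWithinAt (realFun q.1) (derivWithin (realFun q.1) (Set.Icc 0 1) t)
      (Set.Icc 0 1) t := ((q.2.1.differentiableOn one_ne_zero) t t.2).hasDerivWithinAt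
  have h2 : HasDerivWithinAt (realFun q.1.symm)
      (derivWithin (realFun q.1.symm) (Set.Icc 0 1) (realFun q.1 t))
      (Set.Icc 0 1) (realFun q.1 t) := by
    refine ((q.2.2.1.differentiableOn one_ne_zero) _ ?_).hasDerivWithinAt
    rw [hval]; exact (q.1 t).2
  have h3 := h2.comp (t : ℝ) h1 fun s hs => by
    rw [hval q.1 ⟨s, hs⟩]; exact (q.1 ⟨s, hs⟩).2
  have h4 : HasDerivWithinAt (realFun q.1.symm ∘ realFun q.1) 1 (Set.Icc 0 1) t := by
    refine (hasDerivWithinAt_id (t : ℝ) (Set.Icc 0 1)).congr_of_mem (fun s hs => ?_) t.2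
    rw [Function.comp_apply, hval q.1 ⟨s, hs⟩, hval, q.1.symm_apply_apply, id]
  have h5 := hU.eq_deriv _ h3 h4
  rw [DiffPlus.der, iteratedDerivWithin_one]
  intro h6
  rw [show derivWithin (realFun q.1) (Set.Icc 0 1) (t : ℝ) = 0 from h6, mul_zero] at h5
  exact zero_ne_one h5

/-- The `C^1` topology on `Diff_+^1(I)`: uniform convergence of the functions and of their first
derivatives. -/
noncomputable instance : TopologicalSpace (DiffPlus 1) :=
  TopologicalSpace.induced
    (fun q => ((⟨fun t => (q.1 t : ℝ), by fun_prop⟩ : C(I, ℝ)),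
      (⟨fun t => q.der 1 t, q.continuous_der_one⟩ : C(I, ℝ)))) inferInstance

/-- The Borel sets of `Diff_+^1(I)`. -/
noncomputable instance : MeasurableSpace (DiffPlus 1) := borel _

instance : BorelSpace (DiffPlus 1) := ⟨rfl⟩

/-- The map `A : Diff_+^1(I) → C_0(I)`, `A q t = log (q' t) - log (q' 0)`. -/
noncomputable def logDer (q : DiffPlus 1) : C(I, ℝ)₀ where
  toFun t := Real.log (q.der 1 t) - Real.log (q.der 1 0)
  continuous_toFun := (q.continuous_der_one.log q.der_one_ne_zero).sub continuous_const
  map_zero' := by simp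

/-- The measure `ν` on `Diff_+^1(I)`: `ν X = w (A '' X)`, with `w` the Wiener measure. -/
noncomputable def nu : Measure (DiffPlus 1) := Measure.comap logDer wienerMeasure

/-- `E_δ = Diff_+^{1,δ}(I)`: the elements of `Diff_+^1(I)` with `δ`-Hölder derivative. -/
def DiffHolder (δ : ℝ) : Type :=
  {q : DiffPlus 1 // ∃ C : ℝ, ∀ s t : I, |q.der 1 t - q.der 1 s| ≤ C * |(t : ℝ) - s| ^ δ}

noncomputable instance (δ : ℝ) : MeasurableSpace (DiffHolder δ) :=
  inferInstanceAs (MeasurableSpace (Subtype _))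

/-- The measure `ν` on `E_δ`. -/
noncomputable def nuHolder (δ : ℝ) : Measure (DiffHolder δ) :=
  Measure.comap Subtype.val nu

/-- The product measure `ν_n = ν ⊗ ⋯ ⊗ ν` on `E_δ^n`. -/
noncomputable def nuProd (δ : ℝ) (n : ℕ) : Measure (Fin n → DiffHolder δ) :=
  Measure.pi fun _ => nuHolder δ

/-- The moment `M_l = ∫_{E_δ} q'(1)^l dν`. -/
noncomputable def moment (δ : ℝ) (l : ℕ) : ℝ := ∫ q : DiffHolder δ, q.1.der 1 1 ^ l ∂nuHolder δ

/-- The constant `c_4 = 1 + M_1 + M_2 + ∫_{E_δ} ∫_0^1 q'(t)^2 dt dν`. -/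
noncomputable def c4 (δ : ℝ) : ℝ :=
  1 + moment δ 1 + moment δ 2 +
    ∫ q : DiffHolder δ, (∫ t in (0 : ℝ)..1, q.1.der 1 t ^ 2) ∂nuHolder δ

/-- The constant `C_g = 1 + max_t (|g''/g'| + |(g''/g')^2| + |g'''/g'|)`. -/
noncomputable def constC (g : DiffPlus 3) : ℝ :=
  1 + ⨆ t : I, (|g.der 2 t / g.der 1 t| + |(g.der 2 t / g.der 1 t) ^ 2| + |g.der 3 t / g.der 1 t|)

/-- The Schwarzian derivative `S_g = g'''/g' - (3/2) (g''/g')^2`. -/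
noncomputable def schwarzian (g : DiffPlus 3) (t : ℝ) : ℝ :=
  g.der 3 t / g.der 1 t - 3 / 2 * (g.der 2 t / g.der 1 t) ^ 2

/-- `D_n`, each point `(x_1, …, x_{n-1})` given with the conventions `x_0 = 0` and `x_n = 1` as
the full vector `(x_0, …, x_n)`, so `0 = x_0 < x_1 < ⋯ < x_{n-1} < x_n = 1`. -/
def partitions (n : ℕ) : Set (Fin (n + 1) → ℝ) :=
  {x | x 0 = 0 ∧ x (Fin.last n) = 1 ∧ StrictMono x}

/-- The length `x_k - x_{k-1}`; the index `k : Fin n` stands for the `k + 1`-st interval. -/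
def gap {n : ℕ} (x : Fin (n + 1) → ℝ) (k : Fin n) : ℝ := x k.succ - x k.castSucc

/-- `‖x‖ = max_k (x_k - x_{k-1})`. -/
noncomputable def mesh {n : ℕ} (x : Fin (n + 1) → ℝ) : ℝ := ⨆ k : Fin n, gap x k

/-- `X_k = (x_k - x_{k-1}) (g''(x_{k-1})/g'(x_{k-1}) q_k'(0) - g''(x_k)/g'(x_k) q_k'(1))`. -/
noncomputable def termX {δ : ℝ} {n : ℕ} (g : DiffPlus 3) (x : Fin (n + 1) → ℝ) (k : Fin n)
    (q : Fin n → DiffHolder δ) : ℝ :=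
  gap x k * (g.der 2 (x k.castSucc) / g.der 1 (x k.castSucc) * (q k).1.der 1 0 -
    g.der 2 (x k.succ) / g.der 1 (x k.succ) * (q k).1.der 1 1)

/-- `Y_k = (x_k - x_{k-1})^2 ∫_0^1 S_g(x_{k-1} + (x_k - x_{k-1}) q_k(t)) q_k'(t)^2 dt`. -/
noncomputable def termY {δ : ℝ} {n : ℕ} (g : DiffPlus 3) (x : Fin (n + 1) → ℝ) (k : Fin n)
    (q : Fin n → DiffHolder δ) : ℝ :=
  gap x k ^ 2 * ∫ t in (0 : ℝ)..1,
    schwarzian g (x k.castSucc + gap x k * (q k).1.fn t) * (q k).1.der 1 t ^ 2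

/-- `f_1 = ∑ X_k`. -/
noncomputable def f1 {δ : ℝ} {n : ℕ} (g : DiffPlus 3) (x : Fin (n + 1) → ℝ)
    (q : Fin n → DiffHolder δ) : ℝ := ∑ k, termX g x k q

/-- `f_2 = ∑ Y_k`. -/
noncomputable def f2 {δ : ℝ} {n : ℕ} (g : DiffPlus 3) (x : Fin (n + 1) → ℝ)
    (q : Fin n → DiffHolder δ) : ℝ := ∑ k, termY g x k q

end WienerDiff

namespace WienerDiff

/-! Put ρ = ε^(1/3), so that the mesh is at most ρ³. The first sum f₁ is controlled by Chebyshev's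
inequality around its mean, the second sum f₂ by Markov's inequality. Off two events of measure at
most ρ each, |f₁ + f₂| ≤ |E f₁| + |f₁ - E f₁| + |f₂| is below (1 + 1 + 2) c₄ C_g ρ.

The mean of f₁ is small because q'(0) and q'(1) have the same moments under ν
(`integral_der_zero_pow`). Hence E X_k is the gap times M₁ times the difference of g''/g' at the two
ends of the interval. This ratio is C_g-Lipschitz (`abs_ratio_sub_le`), so E X_k is quadratic in the
gap. The X_k depend on different coordinates of a product measure, so the variance of f₁ is the sum
of theirs, each again quadratic in the gap. The Y_k carry the square of the gap explicitly. As the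
gaps sum to 1, |E f₁|, Var f₁ and E |f₂| are all of the order of the mesh.

The facts about ν are read off Wiener measure. The map A is a homeomorphism with inverse x ↦ (q with
q' = e^x / Z), where Z = ∫₀¹ e^x (`logDerHomeo`), so ν is the image of Wiener measure under this
inverse (`nu_eq_map`). Brownian paths are δ-Hölder for δ < 1/2 (`ae_holder`), which gives E_δ full
measure. Jensen's inequality bounds q'(t)² by an average of exponentials of single Gaussian
increments (`density_sq_le`), so second moments are finite. Finally q'(0) = 1/Z and q'(1) = 1/(Z
e^(-x(1))) are equal in law because t ↦ x(1-t) - x(1) is again Brownian (`map_expInt_rev`). -/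

theorem realFun_coe (f : I ≃ₜ I) (t : I) : realFun f t = f t := Set.IccExtend_val _ _ t

/-! ### Diffeomorphisms as primitives of their derivatives. -/

/-- The primitive vanishing at `0` of a continuous function on `[0, 1]`. -/
noncomputable def prim : C(I, ℝ) →L[ℝ] C(I, ℝ) :=
  LinearMap.mkContinuous
    { toFun := fun f =>
        { toFun := fun t => ∫ s in (0 : ℝ)..t, Set.IccExtend (zero_le_one' ℝ) f s
          continuous_toFun := by
            have h : Continuous (Set.IccExtend (zero_le_one' ℝ) f) := f.continuous.Icc_extend'
            exact (intervalIntegral.continuous_primitive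
              (fun a b => h.intervalIntegrable a b) 0).comp continuous_subtype_val }
      map_add' := fun f g => by
        ext t
        exact intervalIntegral.integral_add
          ((f.continuous.Icc_extend' (h := zero_le_one' ℝ)).intervalIntegrable _ _)
          ((g.continuous.Icc_extend' (h := zero_le_one' ℝ)).intervalIntegrable _ _)
      map_smul' := fun c f => by
        ext t
        exact intervalIntegral.integral_const_mul c _ } 1 fun f => by
    rw [one_mul, ContinuousMap.norm_le _ (norm_nonneg _)]
    intro t
    refine (intervalIntegral.norm_integral_le_of_norm_le_const (C := ‖f‖)
      fun s _ => f.norm_coe_le_norm _).trans ?_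
    rw [sub_zero, abs_of_nonneg t.2.1]
    exact mul_le_of_le_one_right (norm_nonneg _) t.2.2

theorem prim_apply (f : C(I, ℝ)) (t : I) :
    prim f t = ∫ s in (0 : ℝ)..t, Set.IccExtend (zero_le_one' ℝ) f s := rfl

/-- The derivative of `q` as a continuous function on `[0, 1]`. -/
noncomputable def DiffPlus.derMap (q : DiffPlus 1) : C(I, ℝ) :=
  ⟨fun t => q.der 1 t, q.continuous_der_one⟩

theorem DiffPlus.derMap_apply (q : DiffPlus 1) (t : I) : q.derMap t = q.der 1 t := rfl

theorem DiffPlus.hasDerivWithinAt (q : DiffPlus 1) (t : I) :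
    HasDerivWithinAt q.fn (q.der 1 t) (Set.Icc 0 1) t := by
  rw [DiffPlus.der, iteratedDerivWithin_one]
  exact ((q.2.1.differentiableOn one_ne_zero) t t.2).hasDerivWithinAt

theorem DiffPlus.fn_eq_prim (q : DiffPlus 1) (t : I) : q.fn t = prim q.derMap t := by
  have hc : Continuous (Set.IccExtend (zero_le_one' ℝ) q.derMap) :=
    q.derMap.continuous.Icc_extend'
  have h := intervalIntegral.integral_eq_sub_of_hasDerivAt_of_le (f := q.fn)
    (f' := Set.IccExtend (zero_le_one' ℝ) q.derMap) t.2.1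
    (q.2.1.continuousOn.mono (Set.Icc_subset_Icc_right t.2.2)) (fun s hs => by
      have hs' : s ∈ Set.Ioo (0 : ℝ) 1 := ⟨hs.1, hs.2.trans_le t.2.2⟩
      rw [Set.IccExtend_of_mem _ _ (Set.Ioo_subset_Icc_self hs')]
      exact (q.hasDerivWithinAt ⟨s, Set.Ioo_subset_Icc_self hs'⟩).hasDerivAt
        (Icc_mem_nhds hs'.1 hs'.2)) (hc.intervalIntegrable _ _)
  have h0 : q.fn 0 = 0 := by
    have := realFun_coe q.1 0
    rw [q.2.2.2.1] at this
    exact this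
  rw [prim_apply, h, h0, sub_zero]

theorem DiffPlus.fn_one {r : ℕ} (q : DiffPlus r) : q.fn 1 = 1 := by
  have := realFun_coe q.1 1
  rw [q.2.2.2.2] at this
  exact this

/-- A continuous derivative without zeros keeps its sign by the intermediate value theorem. Were it
negative, its integral q(1) = 1 would be at most 0. -/
theorem DiffPlus.der_one_pos (q : DiffPlus 1) (t : I) : 0 < q.der 1 t := by
  by_contra h
  have ht : q.der 1 t < 0 := lt_of_le_of_ne (not_lt.1 h) (q.der_one_ne_zero t)
  have hneg : ∀ s : I, q.der 1 s ≤ 0 := by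
    intro s
    by_contra hs
    obtain ⟨u, hu⟩ := mem_range_of_exists_le_of_exists_ge q.continuous_der_one
      ⟨t, ht.le⟩ ⟨s, (not_le.1 hs).le⟩
    exact q.der_one_ne_zero u hu
  have h1 := q.fn_eq_prim 1
  rw [prim_apply] at h1
  have h2 : (∫ s in (0 : ℝ)..(1 : I), Set.IccExtend (zero_le_one' ℝ) q.derMap s) ≤ 0 := by
    rw [← neg_nonneg, ← intervalIntegral.integral_neg]
    exact intervalIntegral.integral_nonneg (by simp) fun s _ => by
      rw [neg_nonneg]; exact hneg _
  have h3 : q.fn ((1 : I) : ℝ) = 1 := q.fn_one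
  linarith

/-! ### The inverse of `logDer`, and ν as an image of Wiener measure. -/

/-- The exponential of a path. -/
noncomputable def expPath (x : C(I, ℝ)₀) : C(I, ℝ) := ⟨fun t => Real.exp (x t), by fun_prop⟩

theorem expPath_apply (x : C(I, ℝ)₀) (t : I) : expPath x t = Real.exp (x t) := rfl

theorem continuous_expPath : Continuous expPath := by
  have h1 : Continuous fun x : C(I, ℝ)₀ => (x : C(I, ℝ)) :=
    continuous_induced_dom
  exact (ContinuousMap.continuous_postcomp ⟨Real.exp, Real.continuous_exp⟩).comp h1

/-- The integral of the exponential of a path. -/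
noncomputable def expInt (x : C(I, ℝ)₀) : ℝ := prim (expPath x) 1

theorem continuous_expInt : Continuous expInt :=
  (continuous_eval_const (1 : I)).comp (prim.continuous.comp continuous_expPath)

theorem prim_strictMono {f : C(I, ℝ)} (hf : ∀ t, 0 < f t) : StrictMono (prim f) := by
  intro s t hst
  have hc : Continuous (Set.IccExtend (zero_le_one' ℝ) f) := f.continuous.Icc_extend'
  rw [← sub_pos, prim_apply, prim_apply, intervalIntegral.integral_interval_sub_left
    (hc.intervalIntegrable _ _) (hc.intervalIntegrable _ _)]
  exact intervalIntegral.intervalIntegral_pos_of_pos (hc.intervalIntegrable _ _)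
    (fun u => hf _) hst

theorem prim_zero (f : C(I, ℝ)) : prim f 0 = 0 := by
  rw [prim_apply]; exact intervalIntegral.integral_same

theorem expInt_pos (x : C(I, ℝ)₀) : 0 < expInt x := by
  have h := prim_strictMono (f := expPath x) (fun t => Real.exp_pos _) (zero_lt_one' I)
  rwa [prim_zero] at h

/-- Extended to the line by constants, f stays above its positive minimum on [0,1]. Its primitive G
therefore grows at least linearly in both directions and is a C¹ diffeomorphism of ℝ. It restricts
to [0,1] because G(0) = 0 and G(1) = 1. Working on all of ℝ makes the ordinary inverse function
theorem available at the endpoints. -/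
theorem exists_diffPlus (f : C(I, ℝ)) (hf : ∀ t, 0 < f t) (h1 : prim f 1 = 1) :
    ∃ q : DiffPlus 1, q.derMap = f := by
  set F : ℝ → ℝ := Set.IccExtend (zero_le_one' ℝ) f with hF
  have hc : Continuous F := f.continuous.Icc_extend'
  have hFpos : ∀ s, 0 < F s := fun s => hf _
  set G : ℝ → ℝ := fun t => ∫ s in (0 : ℝ)..t, F s with hG
  have hd : ∀ t, HasDerivAt G (F t) t := fun t => (hc.integral_hasStrictDerivAt 0 t).hasDerivAt
  have hderiv : deriv G = F := funext fun t => (hd t).deriv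
  have hGc : Continuous G := continuous_iff_continuousAt.2 fun t => (hd t).continuousAt
  have hmono : StrictMono G := strictMono_of_deriv_pos fun t => by rw [hderiv]; exact hFpos t
  have hG0 : G 0 = 0 := intervalIntegral.integral_same
  have hG1 : G 1 = 1 := h1
  -- The minimum f u > 0 serves as a lower slope of G, which forces surjectivity.
  obtain ⟨u, -, hu⟩ := isCompact_univ.exists_isMinOn (Set.univ_nonempty (α := I))
    f.continuous.continuousOn
  have hlow : ∀ s, f u ≤ F s := fun s => hu (Set.mem_univ _)
  have hslope : ∀ a b, a ≤ b → f u * (b - a) ≤ G b - G a := by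
    intro a b hab
    have hdiff : Differentiable ℝ G := fun t => (hd t).differentiableAt
    exact mul_sub_le_image_sub_of_le_deriv hdiff (fun t => by rw [hderiv]; exact hlow t) hab
  have htop : Tendsto G atTop atTop := by
    refine tendsto_atTop_mono' _ ?_ (tendsto_id.const_mul_atTop (hf u))
    filter_upwards [eventually_ge_atTop 0] with t ht
    have := hslope 0 t ht
    rw [hG0] at this
    simpa using this
  have hbot : Tendsto G atBot atBot := by
    refine tendsto_atBot_mono' _ ?_ (tendsto_id.const_mul_atBot (hf u))
    filter_upwards [eventually_le_atBot 0] with t ht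
    have := hslope t 0 ht
    rw [hG0] at this
    simp only [id]
    linarith
  set H : ℝ ≃ₜ ℝ := (hmono.orderIsoOfSurjective G (hGc.surjective htop hbot)).toHomeomorph with hH
  have hHG : ∀ t, H t = G t := fun t => rfl
  have hGsmooth : ContDiff ℝ 1 G := contDiff_one_iff_deriv.2
    ⟨fun t => (hd t).differentiableAt, by rw [hderiv]; exact hc⟩
  have hHsymm : ContDiff ℝ 1 H.symm :=
    H.contDiff_symm_deriv (f' := F) (fun t => (hFpos t).ne') hd hGsmooth
  have hHm : ∀ {a b}, H a ≤ H b ↔ a ≤ b := hmono.le_iff_le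
  have hmap : ∀ t : I, G t ∈ I := fun t =>
    ⟨hG0 ▸ hmono.monotone t.2.1, (hmono.monotone t.2.2).trans_eq hG1⟩
  have hmap' : ∀ t : I, H.symm t ∈ I := fun t => by
    constructor
    · rw [← hHm, H.apply_symm_apply, hHG, hG0]; exact t.2.1
    · rw [← hHm, H.apply_symm_apply, hHG, hG1]; exact t.2.2
  let e : I ≃ₜ I :=
    { toFun := fun t => ⟨G t, hmap t⟩
      invFun := fun t => ⟨H.symm t, hmap' t⟩
      left_inv := fun t => Subtype.ext (H.symm_apply_apply t)
      right_inv := fun t => Subtype.ext (H.apply_symm_apply t)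
      continuous_toFun := by fun_prop
      continuous_invFun := by
        have := H.symm.continuous
        fun_prop }
  have he : Set.EqOn (realFun e) G (Set.Icc 0 1) := fun t ht => realFun_coe e ⟨t, ht⟩
  have he' : Set.EqOn (realFun e.symm) H.symm (Set.Icc 0 1) := fun t ht =>
    realFun_coe e.symm ⟨t, ht⟩
  let q : DiffPlus 1 := ⟨e, hGsmooth.contDiffOn.congr fun t ht => he ht,
    hHsymm.contDiffOn.congr fun t ht => he' ht, Subtype.ext hG0, Subtype.ext hG1⟩
  refine ⟨q, ?_⟩
  ext t
  rw [DiffPlus.derMap_apply, DiffPlus.der, iteratedDerivWithin_one]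
  have h2 : HasDerivWithinAt (realFun e) (F t) (Set.Icc 0 1) t :=
    (hd t).hasDerivWithinAt.congr_of_mem he t.2
  refine (h2.derivWithin (uniqueDiffOn_Icc zero_lt_one t t.2)).trans ?_
  exact Set.IccExtend_val _ _ t

theorem DiffPlus.ext_derMap {p q : DiffPlus 1} (h : p.derMap = q.derMap) : p = q := by
  refine Subtype.ext (Homeomorph.ext fun t => Subtype.ext ?_)
  have hp := p.fn_eq_prim t
  have hq := q.fn_eq_prim t
  rw [h, ← hq] at hp
  exact (realFun_coe p.1 t).symm.trans (hp.trans (realFun_coe q.1 t))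

/-- The derivative of the diffeomorphism with a given logarithmic derivative. -/
noncomputable def normExp (x : C(I, ℝ)₀) : C(I, ℝ) := (expInt x)⁻¹ • expPath x

theorem normExp_apply (x : C(I, ℝ)₀) (t : I) : normExp x t = (expInt x)⁻¹ * Real.exp (x t) := rfl

theorem prim_normExp_one (x : C(I, ℝ)₀) : prim (normExp x) 1 = 1 := by
  rw [normExp, map_smul]
  exact inv_mul_cancel₀ (expInt_pos x).ne'

/-- The inverse of `logDer`. -/
noncomputable def ofPath (x : C(I, ℝ)₀) : DiffPlus 1 :=
  (exists_diffPlus (normExp x) (fun _ => mul_pos (inv_pos.2 (expInt_pos x)) (Real.exp_pos _))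
    (prim_normExp_one x)).choose

theorem derMap_ofPath (x : C(I, ℝ)₀) : (ofPath x).derMap = normExp x :=
  (exists_diffPlus (normExp x) (fun _ => mul_pos (inv_pos.2 (expInt_pos x)) (Real.exp_pos _))
    (prim_normExp_one x)).choose_spec

theorem der_ofPath (x : C(I, ℝ)₀) (t : I) :
    (ofPath x).der 1 t = (expInt x)⁻¹ * Real.exp (x t) := by
  rw [← DiffPlus.derMap_apply, derMap_ofPath, normExp_apply]

theorem logDer_apply (q : DiffPlus 1) (t : I) :
    logDer q t = Real.log (q.der 1 t) - Real.log (q.der 1 0) := rfl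

theorem logDer_ofPath (x : C(I, ℝ)₀) : logDer (ofPath x) = x := by
  refine ContinuousMapZero.ext fun t => ?_
  have h0 := der_ofPath x 0
  have hne : (expInt x)⁻¹ ≠ 0 := inv_ne_zero (expInt_pos x).ne'
  rw [show ((0 : I) : ℝ) = 0 from rfl] at h0
  rw [logDer_apply, h0, der_ofPath, Real.log_mul hne (Real.exp_pos _).ne',
    Real.log_mul hne (Real.exp_pos _).ne', Real.log_exp, Real.log_exp, map_zero]
  ring

theorem expPath_logDer (q : DiffPlus 1) : expPath (logDer q) = (q.der 1 0)⁻¹ • q.derMap := by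
  ext t
  have h0 : 0 < q.der 1 0 := q.der_one_pos 0
  rw [expPath_apply, logDer_apply, Real.exp_sub, Real.exp_log (q.der_one_pos t), Real.exp_log h0,
    div_eq_inv_mul]
  rfl

theorem ofPath_logDer (q : DiffPlus 1) : ofPath (logDer q) = q := by
  refine DiffPlus.ext_derMap ?_
  have h0 : 0 < q.der 1 0 := q.der_one_pos 0
  have h1 : prim q.derMap 1 = 1 := by rw [← q.fn_eq_prim]; exact q.fn_one
  -- The path A(q) determines q' up to the factor q'(0). The normalisation ∫₀¹ q' = 1 recovers that
  -- factor.
  have hZ : expInt (logDer q) = (q.der 1 0)⁻¹ := by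
    rw [expInt, expPath_logDer, map_smul]
    change (q.der 1 0)⁻¹ * prim q.derMap 1 = _
    rw [h1, mul_one]
  rw [derMap_ofPath, normExp, hZ, expPath_logDer, smul_smul, inv_inv, mul_inv_cancel₀ h0.ne',
    one_smul]

theorem DiffPlus.continuous_pair : Continuous fun q : DiffPlus 1 =>
    ((⟨fun t => (q.1 t : ℝ), by fun_prop⟩ : C(I, ℝ)), q.derMap) :=
  continuous_induced_dom

theorem DiffPlus.continuous_derMap : Continuous DiffPlus.derMap :=
  continuous_snd.comp DiffPlus.continuous_pair

theorem DiffPlus.continuous_val : Continuous fun q : DiffPlus 1 =>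
    (⟨fun t => (q.1 t : ℝ), by fun_prop⟩ : C(I, ℝ)) :=
  continuous_fst.comp DiffPlus.continuous_pair

/-- The C¹ topology is induced by the pair (q, q'). Here q' is the normalised exponential of the
path and q is its primitive, both continuous in the path. -/
theorem continuous_ofPath : Continuous ofPath := by
  refine continuous_induced_rng.2 ?_
  have hN : Continuous normExp :=
    (continuous_expInt.inv₀ fun x => (expInt_pos x).ne').smul continuous_expPath
  refine Continuous.prodMk ?_ ?_
  · convert prim.continuous.comp hN using 2 with x
    ext t
    rw [Function.comp_apply, ← derMap_ofPath, ← DiffPlus.fn_eq_prim]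
    exact (realFun_coe _ t).symm
  · convert hN using 2 with x
    exact derMap_ofPath x

theorem continuous_logDer : Continuous logDer := by
  refine continuous_induced_rng.2 ?_
  refine ContinuousMap.continuous_of_continuous_uncurry _ ?_
  have h1 : Continuous fun p : DiffPlus 1 × I => p.1.derMap p.2 :=
    (DiffPlus.continuous_derMap.comp continuous_fst).eval continuous_snd
  have h2 : Continuous fun p : DiffPlus 1 × I => p.1.derMap 0 :=
    (DiffPlus.continuous_derMap.comp continuous_fst).eval continuous_const
  exact (h1.log fun p => (p.1.der_one_pos p.2).ne').sub (h2.log fun p => (p.1.der_one_pos 0).ne')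

/-- `logDer` is a homeomorphism. -/
noncomputable def logDerHomeo : DiffPlus 1 ≃ₜ C(I, ℝ)₀ where
  toFun := logDer
  invFun := ofPath
  left_inv := ofPath_logDer
  right_inv := logDer_ofPath
  continuous_toFun := continuous_logDer
  continuous_invFun := continuous_ofPath

/-- A comap along a homeomorphism is the image under its inverse. This turns every ν-integral into a
Wiener integral. -/
theorem nu_eq_map : nu = wienerMeasure.map ofPath :=
  (MeasurableEquiv.map_symm logDerHomeo.toMeasurableEquiv).symm

/-! ### Hölder continuity of Brownian paths. -/

/-- Chaining: s and t are approximated from below by dyadic points of increasing level. The steps of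
each chain form a geometric series of ratio r = 2^(-δ). At the level n where 2^(-n) is comparable to
t - s, the two chains start at equal or adjacent dyadic points. -/
theorem abs_sub_le_of_dyadic_increments {X : ℝ → ℝ} (hX : Continuous X) {K δ : ℝ} (hδ : 0 < δ)
    (h : ∀ n j : ℕ, |X ((j + 1) / 2 ^ n) - X (j / 2 ^ n)| ≤ K * ((1 / 2 : ℝ) ^ δ) ^ n) :
    ∃ C : ℝ, ∀ s t : ℝ, 0 ≤ s → s < t → t - s ≤ 1 → |X t - X s| ≤ C * (t - s) ^ δ := by
  set r : ℝ := (1 / 2 : ℝ) ^ δ with hr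
  have hr0 : 0 < r := by positivity
  have hr1 : r < 1 := Real.rpow_lt_one (by norm_num) (by norm_num) hδ
  have hK : 0 ≤ K := by simpa using (abs_nonneg _).trans (h 0 0)
  have hadj : ∀ n i j : ℕ, i ≤ j → j ≤ i + 1 → |X (j / 2 ^ n) - X (i / 2 ^ n)| ≤ K * r ^ n := by
    intro n i j h1 h2
    rcases Nat.le_and_le_add_one_iff.1 ⟨h1, h2⟩ with rfl | rfl
    · simp; positivity
    · push_cast; exact h n i
  set d : ℝ → ℕ → ℝ := fun t n => (⌊2 ^ n * t⌋₊ : ℝ) / 2 ^ n with hd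
  have hdt : ∀ t, 0 ≤ t → Tendsto (d t) atTop (𝓝 t) := by
    intro t ht
    have h2 : Tendsto (fun n : ℕ => (2 : ℝ) ^ n) atTop atTop :=
      tendsto_pow_atTop_atTop_of_one_lt one_lt_two
    refine ((tendsto_nat_floor_mul_div_atTop ht).comp h2).congr fun n => ?_
    simp only [Function.comp_apply, hd, mul_comm]
  have hstep : ∀ t, 0 ≤ t → ∀ n, dist (X (d t n)) (X (d t (n + 1))) ≤ K * r ^ n := by
    intro t ht n
    have e : d t n = ((2 * ⌊2 ^ n * t⌋₊ : ℕ) : ℝ) / 2 ^ (n + 1) := by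
      simp only [hd]; push_cast; field_simp; ring
    have h1 : 2 * ⌊2 ^ n * t⌋₊ ≤ ⌊2 ^ (n + 1) * t⌋₊ := by
      apply Nat.le_floor
      push_cast
      have := Nat.floor_le (a := 2 ^ n * t) (by positivity)
      rw [pow_succ]; linarith
    have h2 : ⌊2 ^ (n + 1) * t⌋₊ ≤ 2 * ⌊2 ^ n * t⌋₊ + 1 := by
      rw [← Nat.lt_add_one_iff, Nat.floor_lt (by positivity)]
      push_cast
      have := Nat.lt_floor_add_one (2 ^ n * t)
      rw [pow_succ]; linarith
    rw [dist_comm, Real.dist_eq, e]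
    refine (hadj (n + 1) _ _ h1 h2).trans ?_
    rw [pow_succ]
    gcongr
    exact mul_le_of_le_one_right (by positivity) hr1.le
  have htail : ∀ t, 0 ≤ t → ∀ n, |X (d t n) - X t| ≤ K * r ^ n / (1 - r) := fun t ht n =>
    dist_le_of_le_geometric_of_tendsto r K hr1 (hstep t ht)
      ((hX.tendsto t).comp (hdt t ht)) n
  have h1r : 0 < 1 - r := by linarith
  refine ⟨(2 * (K / (1 - r)) + K) * 2 ^ δ, fun s t hs hst h1 => ?_⟩
  -- The level satisfies 2^(-n-1) < t - s ≤ 2^(-n). The upper bound makes the level-n floors of s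
  -- and t differ by at most one. The lower bound gives r^n ≤ 2^δ (t - s)^δ, whence the factor 2^δ
  -- in the constant.
  obtain ⟨n, hn1, hn2⟩ := exists_nat_pow_near_of_lt_one (sub_pos.2 hst) h1
    (show (0 : ℝ) < 1 / 2 by norm_num) (by norm_num)
  have ht : 0 ≤ t := hs.trans hst.le
  have hn3 : 2 ^ n * t ≤ 2 ^ n * s + 1 := by
    have h3 : 2 ^ n * (t - s) ≤ 2 ^ n * (1 / 2) ^ n := by gcongr
    rw [← mul_pow] at h3
    norm_num at h3
    linarith
  have hmid : |X (d t n) - X (d s n)| ≤ K * r ^ n := by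
    refine hadj n _ _ (Nat.floor_mono (by gcongr)) ?_
    rw [← Nat.floor_add_one (by positivity)]
    exact Nat.floor_mono hn3
  have hrn : r ^ n ≤ 2 ^ δ * (t - s) ^ δ := by
    rw [← Real.mul_rpow (by norm_num) (sub_pos.2 hst).le, hr, ← Real.rpow_natCast,
      ← Real.rpow_mul (by norm_num), mul_comm δ, Real.rpow_mul (by norm_num), Real.rpow_natCast]
    refine Real.rpow_le_rpow (by positivity) ?_ hδ.le
    rw [pow_succ] at hn1
    linarith
  have ha := htail s hs n
  have hb := htail t ht n
  calc |X t - X s| ≤ K * r ^ n / (1 - r) + K * r ^ n + K * r ^ n / (1 - r) := by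
        rw [abs_le] at *
        constructor <;> linarith
    _ = (2 * (K / (1 - r)) + K) * r ^ n := by ring
    _ ≤ _ := by
        rw [mul_assoc]
        gcongr

instance : IsProbabilityMeasure wienerMeasure := isWienerMeasure_wienerMeasure.isProbabilityMeasure

/-- A path, extended to the real line by constants. -/
noncomputable def extend (x : C(I, ℝ)₀) : ℝ → ℝ := Set.IccExtend (zero_le_one' ℝ) x

theorem continuous_extend (x : C(I, ℝ)₀) : Continuous (extend x) := by
  have h : Continuous (x : I → ℝ) := x.continuous
  exact h.Icc_extend'

theorem extend_coe (x : C(I, ℝ)₀) (t : I) : extend x t = x t := Set.IccExtend_val _ _ t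

theorem map_extend_increment {s t : ℝ} (hs : 0 ≤ s) (hst : s ≤ t) (ht : t ≤ 1) :
    wienerMeasure.map (fun x => extend x t - extend x s) =
      gaussianReal 0 (Real.toNNReal (t - s)) := by
  have h := isWienerMeasure_wienerMeasure.map_increment ⟨s, hs, hst.trans ht⟩
    ⟨t, hs.trans hst, ht⟩ hst
  rw [← h]
  congr 1
  funext x
  rw [← extend_coe, ← extend_coe]

theorem measurable_extend (t : ℝ) : Measurable fun x : C(I, ℝ)₀ => extend x t :=
  (continuous_eval_const (Set.projIcc 0 1 zero_le_one t)).measurable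

theorem measurable_extend_sub (s t : ℝ) :
    Measurable fun x : C(I, ℝ)₀ => extend x t - extend x s :=
  (measurable_extend t).sub (measurable_extend s)

theorem lintegral_gaussianReal_enorm_pow_ne_top (m : ℕ) :
    ∫⁻ x, ‖x‖ₑ ^ m ∂gaussianReal 0 1 ≠ ⊤ := by
  rcases Nat.eq_zero_or_pos m with rfl | hm
  · simp
  have h := (memLp_id_gaussianReal (μ := 0) (v := 1) m).eLpNorm_lt_top
  rw [eLpNorm_lt_top_iff_lintegral_rpow_enorm_lt_top (by simpa using hm.ne') (by simp)] at h
  refine ne_of_lt (lt_of_le_of_lt (le_of_eq ?_) h)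
  refine lintegral_congr fun x => ?_
  simp

/-- A level-n increment is 2^(-n/2) times a standard normal variable, so divided by r^n, with r =
2^(-δ), it has m-th absolute moment c a^(mn), where a = 2^(δ-1/2) < 1. Summed over the 2^n intervals
of all levels, these moments form a geometric series of ratio 2a^m. Once this ratio is below 1 the
random sum is almost surely finite, and it bounds every term at once. -/
theorem ae_dyadic_increments {δ : ℝ} (hδ : δ < 1 / 2) : ∀ᵐ x ∂wienerMeasure, ∃ K : ℝ,
    ∀ n j : ℕ, |extend x ((j + 1) / 2 ^ n) - extend x (j / 2 ^ n)| ≤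
      K * ((1 / 2 : ℝ) ^ δ) ^ n := by
  set r : ℝ := (1 / 2 : ℝ) ^ δ with hr
  have hr0 : 0 < r := by positivity
  set a : ℝ := r⁻¹ * (√2)⁻¹ with ha
  have ha0 : 0 ≤ a := by positivity
  have ha1 : a < 1 := by
    rw [ha, ← mul_inv, inv_lt_one₀ (by positivity), hr, Real.sqrt_eq_rpow, one_div,
      Real.inv_rpow (by norm_num), ← Real.rpow_neg (by norm_num), ← Real.rpow_add (by norm_num)]
    exact Real.one_lt_rpow (by norm_num) (by linarith)
  -- The moment order is chosen so that 2a^m < 1, which beats the number 2^n of intervals.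
  obtain ⟨m, hm⟩ := exists_pow_lt_of_lt_one (show (0 : ℝ) < 1 / 2 by norm_num) ha1
  have hm0 : m ≠ 0 := by rintro rfl; norm_num at hm
  set F : (Σ _ : ℕ, ℕ) → C(I, ℝ)₀ → ENNReal := fun p x =>
    if p.2 < 2 ^ p.1 then
      ‖(extend x ((p.2 + 1) / 2 ^ p.1) - extend x (p.2 / 2 ^ p.1)) / r ^ p.1‖ₑ ^ m else 0 with hF
  have hmeas : ∀ p, Measurable (F p) := by
    intro p
    simp only [hF]
    have := fun t => measurable_extend t
    split_ifs <;> fun_prop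
  set c : ENNReal := ∫⁻ x, ‖x‖ₑ ^ m ∂gaussianReal 0 1 with hc
  have hctop : c ≠ ⊤ := lintegral_gaussianReal_enorm_pow_ne_top m
  have hint : ∀ p, ∫⁻ x, F p x ∂wienerMeasure ≤
      if p.2 < 2 ^ p.1 then ENNReal.ofReal ((a ^ m) ^ p.1) * c else 0 := by
    intro p
    simp only [hF]
    split_ifs with hp
    · have hp' : ((p.2 : ℝ) + 1) ≤ 2 ^ p.1 := by exact_mod_cast hp
      have h1 := map_extend_increment (s := p.2 / 2 ^ p.1) (t := (p.2 + 1) / 2 ^ p.1)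
        (by positivity) (by gcongr; linarith) (by rw [div_le_one (by positivity)]; exact hp')
      have h2 := gaussianReal_map_const_mul (μ := 0) (v := 1) ((√2)⁻¹ ^ p.1)
      have h3 : Real.toNNReal (((p.2 : ℝ) + 1) / 2 ^ p.1 - p.2 / 2 ^ p.1) =
          NNReal.mk (((√2)⁻¹ ^ p.1) ^ 2) (sq_nonneg _) * 1 := by
        rw [mul_one]
        ext
        rw [← sub_div, add_sub_cancel_left, Real.coe_toNNReal _ (by positivity), NNReal.coe_mk,
          ← pow_mul, mul_comm, pow_mul, inv_pow, Real.sq_sqrt (by norm_num), inv_pow, one_div]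
      rw [h3] at h1
      rw [mul_zero] at h2
      rw [← h2] at h1
      have hme : Measurable fun y : ℝ => ‖y / r ^ p.1‖ₑ ^ m := by fun_prop
      rw [← lintegral_map (f := fun y : ℝ => ‖y / r ^ p.1‖ₑ ^ m) hme
        (measurable_extend_sub _ _), h1,
        lintegral_map hme (by fun_prop), hc, ← lintegral_const_mul _ (by fun_prop)]
      refine lintegral_mono fun y => le_of_eq ?_
      have e : (√2)⁻¹ ^ p.1 * y / r ^ p.1 = a ^ p.1 * y := by
        rw [ha, mul_pow, inv_pow r]
        field_simp
      change ‖(√2)⁻¹ ^ p.1 * y / r ^ p.1‖ₑ ^ m = _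
      rw [e, enorm_mul, mul_pow, Real.enorm_of_nonneg (by positivity),
        ← ENNReal.ofReal_pow (by positivity), ← pow_mul, ← pow_mul, mul_comm m]
    · simp
  have hsum : ∫⁻ x, ∑' p, F p x ∂wienerMeasure ≠ ⊤ := by
    rw [lintegral_tsum fun p => (hmeas p).aemeasurable]
    refine ne_top_of_le_ne_top ?_ (ENNReal.tsum_le_tsum hint)
    rw [ENNReal.tsum_sigma']
    have h1 : ∀ n : ℕ, ∑' j : ℕ, (if j < 2 ^ n then ENNReal.ofReal ((a ^ m) ^ n) * c else 0) =
        ENNReal.ofReal ((2 * a ^ m) ^ n) * c := by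
      intro n
      rw [tsum_eq_sum (s := Finset.range (2 ^ n))
        (fun j hj => if_neg (by simpa using hj)),
        Finset.sum_congr rfl fun j hj => if_pos (Finset.mem_range.1 hj),
        Finset.sum_const, Finset.card_range, nsmul_eq_mul, ← mul_assoc]
      congr 1
      rw [mul_pow 2, ENNReal.ofReal_mul (by positivity)]
      congr 1
      rw [ENNReal.ofReal_pow (by norm_num)]
      norm_num
    simp only [h1]
    rw [ENNReal.tsum_mul_right]
    refine ENNReal.mul_ne_top ?_ hctop
    rw [← ENNReal.ofReal_tsum_of_nonneg (fun n => by positivity)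
      (summable_geometric_of_lt_one (by positivity) (by linarith))]
    exact ENNReal.ofReal_ne_top
  filter_upwards [ae_lt_top (Measurable.tsum hmeas) hsum] with x hx
  have h0 : 0 ≤ (∑' p, F p x).toReal := ENNReal.toReal_nonneg
  refine ⟨1 + (∑' p, F p x).toReal, fun n j => ?_⟩
  rcases lt_or_ge j (2 ^ n) with hj | hj
  · have h1 : F ⟨n, j⟩ x ≤ ∑' p, F p x := ENNReal.le_tsum _
    have h3 := ENNReal.toReal_mono hx.ne h1
    simp only [hF, if_pos hj, ENNReal.toReal_pow, toReal_enorm] at h3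
    have h4 : ‖(extend x ((j + 1) / 2 ^ n) - extend x (j / 2 ^ n)) / r ^ n‖ ≤
        1 + (∑' p, F p x).toReal := by
      by_contra hc
      push Not at hc
      have h5 := le_self_pow₀ (by linarith :
        1 ≤ ‖(extend x ((j + 1) / 2 ^ n) - extend x (j / 2 ^ n)) / r ^ n‖) hm0
      linarith
    rwa [norm_div, Real.norm_eq_abs, Real.norm_of_nonneg (by positivity),
      div_le_iff₀ (by positivity)] at h4
  -- To the right of 1 the extended path is constant, so these increments vanish.
  · have hj' : (2 : ℝ) ^ n ≤ j := by exact_mod_cast hj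
    have h1 : extend x (j / 2 ^ n) = x 1 :=
      Set.IccExtend_of_right_le _ _ (by rw [le_div_iff₀ (by positivity)]; linarith)
    have h2 : extend x ((j + 1) / 2 ^ n) = x 1 :=
      Set.IccExtend_of_right_le _ _ (by rw [le_div_iff₀ (by positivity)]; linarith)
    rw [h1, h2, sub_self, abs_zero]
    positivity

theorem ae_holder {δ : ℝ} (hδ0 : 0 < δ) (hδ : δ < 1 / 2) : ∀ᵐ x ∂wienerMeasure,
    ∃ C : ℝ, ∀ s t : I, |x t - x s| ≤ C * |(t : ℝ) - s| ^ δ := by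
  filter_upwards [ae_dyadic_increments hδ] with x ⟨K, hK⟩
  obtain ⟨C, hC⟩ := abs_sub_le_of_dyadic_increments (continuous_extend x) hδ0 hK
  have key : ∀ s t : I, (s : ℝ) < t → |x t - x s| ≤ C * |(t : ℝ) - s| ^ δ := by
    intro s t hst
    rw [abs_of_pos (sub_pos.2 hst), ← extend_coe, ← extend_coe]
    exact hC s t s.2.1 hst (by linarith [t.2.2, s.2.1])
  refine ⟨C, fun s t => ?_⟩
  rcases lt_trichotomy (s : ℝ) t with h | h | h
  · exact key s t h
  · rw [Subtype.ext h, sub_self, sub_self, abs_zero, Real.zero_rpow hδ0.ne', mul_zero]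
  · rw [abs_sub_comm, abs_sub_comm (t : ℝ)]
    exact key t s h

/-! ### The Hölder class has full ν-measure. -/

/-- The set of diffeomorphisms with `δ`-Hölder derivative. -/
def holderSet (δ : ℝ) : Set (DiffPlus 1) :=
  {q | ∃ C : ℝ, ∀ s t : I, |q.der 1 t - q.der 1 s| ≤ C * |(t : ℝ) - s| ^ δ}

theorem DiffPlus.continuous_eval_der (t : I) : Continuous fun q : DiffPlus 1 => q.der 1 t :=
  (continuous_eval_const t).comp DiffPlus.continuous_derMap

/-- With an integer Hölder constant N fixed, the condition is an intersection of closed conditions.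
The union over N is countable. -/
theorem measurableSet_holderSet (δ : ℝ) : MeasurableSet (holderSet δ) := by
  have e : holderSet δ = ⋃ N : ℕ, ⋂ s : I, ⋂ t : I,
      {q : DiffPlus 1 | |q.der 1 t - q.der 1 s| ≤ N * |(t : ℝ) - s| ^ δ} := by
    ext q
    simp only [holderSet, Set.mem_iUnion, Set.mem_iInter, Set.mem_ofPred_eq]
    constructor
    · rintro ⟨C, hC⟩
      obtain ⟨N, hN⟩ := exists_nat_ge C
      exact ⟨N, fun s t => (hC s t).trans (by gcongr)⟩
    · rintro ⟨N, hN⟩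
      exact ⟨N, hN⟩
  rw [e]
  refine MeasurableSet.iUnion fun N => IsClosed.measurableSet ?_
  refine isClosed_iInter fun s => isClosed_iInter fun t => ?_
  exact isClosed_le ((DiffPlus.continuous_eval_der t).sub (DiffPlus.continuous_eval_der s)).abs
    continuous_const

theorem measurableEmbedding_ofPath : MeasurableEmbedding ofPath :=
  logDerHomeo.symm.measurableEmbedding

theorem measurePreserving_ofPath : MeasurePreserving ofPath wienerMeasure nu :=
  ⟨measurableEmbedding_ofPath.measurable, nu_eq_map.symm⟩

theorem abs_exp_sub_exp_le {a b M : ℝ} (ha : a ≤ M) (hb : b ≤ M) :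
    |Real.exp a - Real.exp b| ≤ Real.exp M * |a - b| := by
  wlog hab : b ≤ a generalizing a b
  · rw [abs_sub_comm, abs_sub_comm a]
    exact this hb ha (le_of_not_ge hab)
  rw [abs_of_nonneg (sub_nonneg.2 (Real.exp_le_exp.2 hab)), abs_of_nonneg (sub_nonneg.2 hab)]
  have h1 : Real.exp b = Real.exp a * Real.exp (b - a) := by rw [← Real.exp_add]; ring_nf
  have h2 := Real.add_one_le_exp (b - a)
  calc _ = Real.exp a * (1 - Real.exp (b - a)) := by rw [h1]; ring
    _ ≤ Real.exp a * (a - b) := mul_le_mul_of_nonneg_left (by linarith) (Real.exp_pos a).le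
    _ ≤ _ := by gcongr

/-- The exponential is Lipschitz with constant e^‖x‖ on the range of the path x, so q' = e^x / Z
inherits the Hölder exponent of x. -/
theorem ae_mem_holderSet {δ : ℝ} (hδ0 : 0 < δ) (hδ : δ < 1 / 2) :
    ∀ᵐ q ∂nu, q ∈ holderSet δ := by
  rw [nu_eq_map, measurableEmbedding_ofPath.ae_map_iff]
  filter_upwards [ae_holder hδ0 hδ] with x ⟨C, hC⟩
  refine ⟨(expInt x)⁻¹ * (Real.exp ‖x‖ * C), fun s t => ?_⟩
  have hZ := inv_pos.2 (expInt_pos x)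
  have hb : ∀ t, x t ≤ ‖x‖ := fun t => (le_abs_self _).trans (x.toContinuousMap.norm_coe_le_norm t)
  rw [der_ofPath, der_ofPath, ← mul_sub, abs_mul, abs_of_pos hZ, mul_assoc, mul_assoc]
  gcongr
  exact (abs_exp_sub_exp_le (hb t) (hb s)).trans (by gcongr; exact hC s t)

/-- The inclusion of `E_δ` in `Diff_+^1(I)`. -/
def DiffHolder.toDiffPlus {δ : ℝ} (q : DiffHolder δ) : DiffPlus 1 := q.1

theorem measurableEmbedding_toDiffPlus (δ : ℝ) :
    MeasurableEmbedding (DiffHolder.toDiffPlus : DiffHolder δ → DiffPlus 1) :=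
  MeasurableEmbedding.subtype_coe (measurableSet_holderSet δ)

theorem nuHolder_eq_comap (δ : ℝ) : nuHolder δ = nu.comap DiffHolder.toDiffPlus := rfl

/-- Since E_δ is measurable and of full measure, restricting ν to it loses nothing. Integrals over
E_δ thereby become Wiener integrals. -/
theorem measurePreserving_toDiffPlus {δ : ℝ} (hδ0 : 0 < δ) (hδ : δ < 1 / 2) :
    MeasurePreserving (DiffHolder.toDiffPlus : DiffHolder δ → DiffPlus 1) (nuHolder δ) nu := by
  refine ⟨(measurableEmbedding_toDiffPlus δ).measurable, ?_⟩
  rw [nuHolder_eq_comap, (measurableEmbedding_toDiffPlus δ).map_comap]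
  refine Measure.restrict_eq_self_of_ae_mem ?_
  have : Set.range (DiffHolder.toDiffPlus : DiffHolder δ → DiffPlus 1) = holderSet δ :=
    Subtype.range_val
  rw [this]
  exact ae_mem_holderSet hδ0 hδ

theorem isProbabilityMeasure_nuHolder {δ : ℝ} (hδ0 : 0 < δ) (hδ : δ < 1 / 2) :
    IsProbabilityMeasure (nuHolder δ) := by
  refine ⟨?_⟩
  have h1 := (measurePreserving_toDiffPlus hδ0 hδ).measure_preimage_emb
    (measurableEmbedding_toDiffPlus δ) Set.univ
  have h2 := measurePreserving_ofPath.measure_preimage_emb measurableEmbedding_ofPath Set.univ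
  rw [Set.preimage_univ] at h1 h2
  rw [h1, ← h2, measure_univ]

theorem integral_nuHolder {δ : ℝ} (hδ0 : 0 < δ) (hδ : δ < 1 / 2) (f : DiffPlus 1 → ℝ) :
    ∫ q : DiffHolder δ, f q.1 ∂nuHolder δ = ∫ x, f (ofPath x) ∂wienerMeasure :=
  ((measurePreserving_toDiffPlus hδ0 hδ).integral_comp (measurableEmbedding_toDiffPlus δ) f).trans
    (measurePreserving_ofPath.integral_comp measurableEmbedding_ofPath f).symm

theorem integrable_nuHolder {δ : ℝ} (hδ0 : 0 < δ) (hδ : δ < 1 / 2) (f : DiffPlus 1 → ℝ) :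
    Integrable (fun q : DiffHolder δ => f q.1) (nuHolder δ) ↔
      Integrable (fun x => f (ofPath x)) wienerMeasure :=
  ((measurePreserving_toDiffPlus hδ0 hδ).integrable_comp_emb
    (measurableEmbedding_toDiffPlus δ)).trans
    (measurePreserving_ofPath.integrable_comp_emb measurableEmbedding_ofPath).symm

/-! ### Second moments of q'(t). -/

theorem continuous_exp_extend (x : C(I, ℝ)₀) : Continuous fun s => Real.exp (extend x s) :=
  (continuous_extend x).rexp

/-- The derivative of the diffeomorphism with logarithmic derivative `x`, extended to the real
line by constants. -/
noncomputable def density (x : C(I, ℝ)₀) (t : ℝ) : ℝ := (expInt x)⁻¹ * Real.exp (extend x t)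

theorem continuous_density (x : C(I, ℝ)₀) : Continuous (density x) :=
  continuous_const.mul (continuous_exp_extend x)

theorem measurable_density (t : ℝ) : Measurable fun x => density x t :=
  continuous_expInt.measurable.inv.mul (measurable_extend t).exp

theorem measurable_uncurry_extend :
    Measurable fun p : C(I, ℝ)₀ × ℝ => extend p.1 p.2 := by
  have h : Measurable (Function.uncurry fun (s : ℝ) (x : C(I, ℝ)₀) => extend x s) :=
    measurable_uncurry_of_continuous_of_measurable continuous_extend measurable_extend
  exact h.comp measurable_swap

theorem measurable_uncurry_density :
    Measurable fun p : C(I, ℝ)₀ × ℝ => density p.1 p.2 :=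
  (continuous_expInt.measurable.comp measurable_fst).inv.mul measurable_uncurry_extend.exp

theorem der_ofPath_eq_density (x : C(I, ℝ)₀) {t : ℝ} (ht : t ∈ Set.Icc (0 : ℝ) 1) :
    (ofPath x).der 1 t = density x t := by
  have h := der_ofPath x ⟨t, ht⟩
  rw [← extend_coe] at h
  exact h

/-- Jensen's inequality for y ↦ y⁻², by integrating its tangent line (3c - 2y)/c³ at the mean c. -/
theorem inv_sq_integral_le {u : ℝ → ℝ} (hu : Continuous u) (hpos : ∀ s, 0 < u s)
    (hc : 0 < ∫ s in (0 : ℝ)..1, u s) :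
    (∫ s in (0 : ℝ)..1, u s)⁻¹ ^ 2 ≤ ∫ s in (0 : ℝ)..1, (u s)⁻¹ ^ 2 := by
  set c := ∫ s in (0 : ℝ)..1, u s with hc'
  have h1 : ∫ s in (0 : ℝ)..1, (3 * c - 2 * u s) / c ^ 3 = c⁻¹ ^ 2 := by
    rw [intervalIntegral.integral_div, intervalIntegral.integral_sub
      (by simp) ((hu.const_mul 2).intervalIntegrable _ _) (f := fun _ => 3 * c)
      (g := fun s => 2 * u s), intervalIntegral.integral_const,
      intervalIntegral.integral_const_mul, ← hc']
    simp only [sub_zero, smul_eq_mul]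
    field_simp
    ring
  rw [← h1]
  refine intervalIntegral.integral_mono_on zero_le_one (Continuous.intervalIntegrable (by fun_prop) _ _)
    (((hu.inv₀ fun s => (hpos s).ne').pow 2).intervalIntegrable _ _) fun s _ => ?_
  have := hpos s
  rw [inv_pow, div_le_iff₀ (by positivity), inv_mul_eq_div, le_div_iff₀ (by positivity)]
  -- The tangent line lies below y⁻² because c³ - 3cy² + 2y³ = (c - y)²(c + 2y).
  nlinarith [mul_nonneg (sq_nonneg (c - u s)) (by positivity : 0 ≤ c + 2 * u s)]

/-- The factor 1/Z depends on the whole path. Jensen's inequality trades it for an average over s,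
leaving single increments, whose exponential moments are explicit. -/
theorem density_sq_le (x : C(I, ℝ)₀) (t : ℝ) : density x t ^ 2 ≤
    ∫ s in (0 : ℝ)..1, Real.exp (2 * (extend x t - extend x s)) := by
  have h := inv_sq_integral_le (continuous_exp_extend x) (fun s => Real.exp_pos _) (expInt_pos x)
  rw [density, mul_pow]
  calc _ ≤ (∫ s in (0 : ℝ)..1, (Real.exp (extend x s))⁻¹ ^ 2) * Real.exp (extend x t) ^ 2 := by
        gcongr; exact h
    _ = _ := by
        rw [← intervalIntegral.integral_mul_const]
        refine intervalIntegral.integral_congr fun s _ => ?_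
        rw [← mul_pow, ← Real.exp_neg, ← Real.exp_add, ← Real.exp_nat_mul]
        congr 1
        push_cast
        ring

theorem lintegral_exp_gaussianReal (c : ℝ) (v : NNReal) :
    ∫⁻ y, ENNReal.ofReal (Real.exp (c * y)) ∂gaussianReal 0 v =
      ENNReal.ofReal (Real.exp (v * c ^ 2 / 2)) := by
  rw [← ofReal_integral_eq_lintegral_ofReal (integrable_exp_mul_gaussianReal c)
    (ae_of_all _ fun y => (Real.exp_pos _).le)]
  have h := congrFun (mgf_id_gaussianReal (μ := 0) (v := v)) c
  rw [zero_mul, zero_add] at h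
  rw [← h]
  rfl

theorem lintegral_exp_increment_le {s t : ℝ} (hs : s ∈ Set.Icc (0 : ℝ) 1)
    (ht : t ∈ Set.Icc (0 : ℝ) 1) :
    ∫⁻ x, ENNReal.ofReal (Real.exp (2 * (extend x t - extend x s))) ∂wienerMeasure ≤
      ENNReal.ofReal (Real.exp 2) := by
  -- The exponential moment is e^(c²(t-s)/2) ≤ e². Allowing c = -2 as well as c = 2 covers both
  -- orders of s and t.
  have key : ∀ s t : ℝ, 0 ≤ s → s ≤ t → t ≤ 1 → ∀ c : ℝ, c ^ 2 = 4 →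
      ∫⁻ x, ENNReal.ofReal (Real.exp (c * (extend x t - extend x s))) ∂wienerMeasure ≤
        ENNReal.ofReal (Real.exp 2) := by
    intro s t hs hst ht c hc
    rw [← lintegral_map (f := fun y : ℝ => ENNReal.ofReal (Real.exp (c * y))) (by fun_prop)
      (measurable_extend_sub s t), map_extend_increment hs hst ht, lintegral_exp_gaussianReal, hc,
      Real.coe_toNNReal _ (sub_nonneg.2 hst)]
    gcongr
    linarith
  rcases le_total s t with h | h
  · exact key s t hs.1 h ht.2 2 (by norm_num)
  · refine le_trans (lintegral_mono fun x => le_of_eq ?_)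
      (key t s ht.1 h hs.2 (-2) (by norm_num))
    congr 2
    ring

theorem lintegral_density_sq_le {t : ℝ} (ht : t ∈ Set.Icc (0 : ℝ) 1) :
    ∫⁻ x, ENNReal.ofReal (density x t ^ 2) ∂wienerMeasure ≤ ENNReal.ofReal (Real.exp 2) := by
  have hmeas : Measurable (Function.uncurry fun (x : C(I, ℝ)₀) (s : ℝ) =>
      ENNReal.ofReal (Real.exp (2 * (extend x t - extend x s)))) := by
    have h2 : Measurable fun p : C(I, ℝ)₀ × ℝ => extend p.1 t :=
      (measurable_extend t).comp measurable_fst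
    exact (((h2.sub measurable_uncurry_extend).const_mul 2).exp).ennreal_ofReal
  calc _ ≤ ∫⁻ x, (∫⁻ s in Set.Ioc (0 : ℝ) 1,
        ENNReal.ofReal (Real.exp (2 * (extend x t - extend x s)))) ∂wienerMeasure := by
        refine lintegral_mono fun x => ?_
        have hc : Continuous fun s => Real.exp (2 * (extend x t - extend x s)) := by
          have := continuous_extend x
          fun_prop
        rw [← ofReal_integral_eq_lintegral_ofReal
          ((hc.intervalIntegrable 0 1).1) (ae_of_all _ fun y => (Real.exp_pos _).le)]
        refine ENNReal.ofReal_le_ofReal ((density_sq_le x t).trans_eq ?_)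
        exact intervalIntegral.integral_of_le zero_le_one
    _ = ∫⁻ s in Set.Ioc (0 : ℝ) 1, (∫⁻ x,
        ENNReal.ofReal (Real.exp (2 * (extend x t - extend x s))) ∂wienerMeasure) :=
        lintegral_lintegral_swap hmeas.aemeasurable
    _ ≤ ∫⁻ s in Set.Ioc (0 : ℝ) 1, ENNReal.ofReal (Real.exp 2) :=
        setLIntegral_mono measurable_const fun s hs =>
          lintegral_exp_increment_le (Set.Ioc_subset_Icc_self hs) ht
    _ = _ := by simp

theorem memLp_density {t : ℝ} (ht : t ∈ Set.Icc (0 : ℝ) 1) :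
    MemLp (fun x => density x t) 2 wienerMeasure := by
  rw [memLp_two_iff_integrable_sq (measurable_density t).aestronglyMeasurable]
  refine ⟨((measurable_density t).pow_const 2).aestronglyMeasurable, ?_⟩
  rw [hasFiniteIntegral_iff_ofReal (ae_of_all _ fun x => sq_nonneg _)]
  exact (lintegral_density_sq_le ht).trans_lt ENNReal.ofReal_lt_top

theorem integrable_integral_density_sq :
    Integrable (fun x => ∫ t in (0 : ℝ)..1, density x t ^ 2) wienerMeasure := by
  have hm : Measurable (Function.uncurry fun (x : C(I, ℝ)₀) (t : ℝ) => density x t ^ 2) :=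
    measurable_uncurry_density.pow_const 2
  have hint : ∀ x : C(I, ℝ)₀, IntegrableOn (fun t => density x t ^ 2) (Set.Ioc (0 : ℝ) 1) :=
    fun x => (((continuous_density x).pow 2).intervalIntegrable 0 1).1
  simp only [intervalIntegral.integral_of_le zero_le_one]
  refine ⟨hm.stronglyMeasurable.integral_prod_right.aestronglyMeasurable, ?_⟩
  rw [hasFiniteIntegral_iff_ofReal (ae_of_all _ fun x => integral_nonneg fun t => sq_nonneg _)]
  calc _ = ∫⁻ x, (∫⁻ t in Set.Ioc (0 : ℝ) 1, ENNReal.ofReal (density x t ^ 2)) ∂wienerMeasure :=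
        lintegral_congr fun x => ofReal_integral_eq_lintegral_ofReal (hint x)
          (ae_of_all _ fun t => sq_nonneg _)
    _ = ∫⁻ t in Set.Ioc (0 : ℝ) 1, ∫⁻ x, ENNReal.ofReal (density x t ^ 2) ∂wienerMeasure :=
        lintegral_lintegral_swap hm.ennreal_ofReal.aemeasurable
    _ ≤ ∫⁻ t in Set.Ioc (0 : ℝ) 1, ENNReal.ofReal (Real.exp 2) :=
        setLIntegral_mono measurable_const fun t ht =>
          lintegral_density_sq_le (Set.Ioc_subset_Icc_self ht)
    _ < ⊤ := by simp

/-! ### Time reversal: q'(0) and q'(1) have equal moments. -/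

/-- The tags are arbitrary because reversal turns left endpoints into right endpoints. -/
theorem tendsto_riemannSum {f : ℝ → ℝ} (hf : Continuous f) {c : ℕ → ℕ → ℝ}
    (hc : ∀ N j : ℕ, j < N → c N j ∈ Set.Icc ((j : ℝ) / N) ((j + 1) / N)) :
    Tendsto (fun N : ℕ => (∑ j ∈ Finset.range N, f (c N j)) / N) atTop
      (𝓝 (∫ s in (0 : ℝ)..1, f s)) := by
  have huc : UniformContinuousOn f (Set.Icc 0 1) :=
    isCompact_Icc.uniformContinuousOn_of_continuous hf.continuousOn
  rw [Metric.tendsto_atTop]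
  intro ε hε
  obtain ⟨η, hη, h⟩ := Metric.uniformContinuousOn_iff.1 huc (ε / 2) (by positivity)
  obtain ⟨N₀, hN₀⟩ := exists_nat_gt (1 / η)
  refine ⟨N₀ + 1, fun N hN => ?_⟩
  have hNpos : (0 : ℝ) < N := by exact_mod_cast (Nat.succ_pos _).trans_le hN
  have hNη : 1 / (N : ℝ) < η := by
    rw [div_lt_comm₀ hNpos hη]
    exact hN₀.trans_le (by exact_mod_cast (Nat.le_succ _).trans hN)
  have hsum := intervalIntegral.sum_integral_adjacent_intervals (f := f) (μ := volume)
    (a := fun j : ℕ => (j : ℝ) / N) (n := N) fun k _ => hf.intervalIntegrable _ _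
  simp only [Nat.cast_zero, zero_div, div_self hNpos.ne', Nat.cast_add, Nat.cast_one] at hsum
  rw [dist_eq_norm, ← hsum, Finset.sum_div, ← Finset.sum_sub_distrib]
  have hle : ∀ j ∈ Finset.range N,
      ‖f (c N j) / N - ∫ s in ((j : ℝ) / N)..((j + 1) / N), f s‖ ≤ ε / 2 * (1 / N) := by
    intro j hj
    have hj' : (j : ℝ) + 1 ≤ N := by exact_mod_cast Finset.mem_range.1 hj
    have hw : ((j : ℝ) + 1) / N - j / N = 1 / N := by ring
    have hsub : Set.Icc ((j : ℝ) / N) ((j + 1) / N) ⊆ Set.Icc 0 1 :=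
      Set.Icc_subset_Icc (by positivity) (by rwa [div_le_one hNpos])
    have e : f (c N j) / N = ∫ s in ((j : ℝ) / N)..((j + 1) / N), f (c N j) := by
      rw [intervalIntegral.integral_const, hw, smul_eq_mul]; ring
    rw [e, ← intervalIntegral.integral_sub (by simp) (hf.intervalIntegrable _ _)]
    have hjj : (j : ℝ) / N ≤ (j + 1) / N := by gcongr; linarith
    refine (intervalIntegral.norm_integral_le_of_norm_le_const (C := ε / 2) fun s hs => ?_).trans
      (by rw [hw, abs_of_pos (by positivity)])
    rw [Set.uIoc_of_le hjj] at hs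
    have hs' := Set.Ioc_subset_Icc_self hs
    have hcj := hc N j (Finset.mem_range.1 hj)
    refine (h _ (hsub hcj) _ (hsub hs') ?_).le
    rw [Real.dist_eq, abs_lt]
    constructor <;> linarith [hs'.1, hs'.2, hcj.1, hcj.2]
  refine (norm_sum_le_of_le _ hle).trans_lt ?_
  rw [Finset.sum_const, Finset.card_range, nsmul_eq_mul]
  have : (N : ℝ) * (ε / 2 * (1 / N)) = ε / 2 := by field_simp
  rw [this]
  linarith

/-- The increments of a path over `N` equal intervals. -/
noncomputable def increments (N : ℕ) (x : C(I, ℝ)₀) (i : Fin N) : ℝ :=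
  extend x ((i + 1) / N) - extend x (i / N)

/-- The increments over `N` equal intervals of the path run backwards. -/
noncomputable def revIncrements (N : ℕ) (x : C(I, ℝ)₀) (i : Fin N) : ℝ :=
  -increments N x i.rev

theorem measurable_increments (N : ℕ) (i : Fin N) : Measurable fun x => increments N x i :=
  measurable_extend_sub _ _

theorem iIndepFun_increments (N : ℕ) :
    iIndepFun (fun i x => increments N x i) wienerMeasure := by
  have hmem : ∀ i : Fin (N + 1), ((i : ℕ) : ℝ) / N ∈ I := fun i =>
    ⟨by positivity, div_le_one_of_le₀ (by exact_mod_cast Nat.lt_succ_iff.1 i.2) (by positivity)⟩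
  have h := isWienerMeasure_wienerMeasure.hasIndepIncrements N (fun i => ⟨_, hmem i⟩)
    (fun i j hij => by
      rw [Subtype.mk_le_mk]
      have : ((i : ℕ) : ℝ) ≤ j := by exact_mod_cast hij
      gcongr)
  convert h using 2 with i
  funext x
  simp only [increments, ← extend_coe, Fin.val_succ, Fin.val_castSucc, Nat.cast_add, Nat.cast_one]

theorem map_increments_apply (N : ℕ) (i : Fin N) :
    wienerMeasure.map (fun x => increments N x i) = gaussianReal 0 (Real.toNNReal (1 / N)) := by
  have hi : ((i : ℕ) : ℝ) + 1 ≤ N := by exact_mod_cast i.2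
  have hN : (0 : ℝ) < N := lt_of_lt_of_le (by positivity) hi
  have h := map_extend_increment (s := (i : ℕ) / N) (t := ((i : ℕ) + 1) / N) (by positivity)
    (by gcongr; linarith) (by rwa [div_le_one hN])
  rw [← sub_div, add_sub_cancel_left] at h
  exact h

/-- The increments are independent, with one common symmetric law. Reversing their order and
changing all signs therefore preserves the joint law. -/
theorem map_revIncrements (N : ℕ) :
    wienerMeasure.map (revIncrements N) = wienerMeasure.map (increments N) := by
  have h1 := (iIndepFun_iff_map_fun_eq_pi_map
    fun i => (measurable_increments N i).aemeasurable).1 (iIndepFun_increments N)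
  have hrev : iIndepFun (fun i x => revIncrements N x i) wienerMeasure :=
    ((iIndepFun_increments N).precomp Fin.rev_injective).comp (fun _ y => -y)
      fun _ => measurable_neg
  have h2 := (iIndepFun_iff_map_fun_eq_pi_map
    fun i => (measurable_increments N (Fin.rev i)).neg.aemeasurable).1 hrev
  refine h2.trans (Eq.trans ?_ h1.symm)
  congr 1
  funext i
  have h4 := gaussianReal_map_neg (μ := 0) (v := Real.toNNReal (1 / (N : ℝ)))
  rw [neg_zero] at h4
  rw [map_increments_apply]
  refine Eq.trans ?_ h4
  rw [← map_increments_apply N i.rev, Measure.map_map measurable_neg (measurable_increments _ _)]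
  rfl

/-- The left Riemann sum over `N` equal intervals of the exponential of the path with given
increments. -/
noncomputable def incrementSum (N : ℕ) (z : Fin N → ℝ) : ℝ :=
  (∑ j ∈ Finset.range N,
    Real.exp (∑ i ∈ Finset.range j, if h : i < N then z ⟨i, h⟩ else 0)) / N

theorem measurable_incrementSum (N : ℕ) : Measurable (incrementSum N) := by
  unfold incrementSum
  refine Measurable.div_const (Finset.measurable_fun_sum _ fun j _ => Measurable.exp ?_) _
  refine Finset.measurable_fun_sum _ fun i _ => ?_
  split_ifs <;> fun_prop

theorem incrementSum_of_telescope (N : ℕ) (z : Fin N → ℝ) (Y : ℕ → ℝ)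
    (h : ∀ i : Fin N, z i = Y (i + 1) - Y i) :
    incrementSum N z = (∑ j ∈ Finset.range N, Real.exp (Y j - Y 0)) / N := by
  unfold incrementSum
  congr 1
  refine Finset.sum_congr rfl fun j hj => ?_
  rw [← Finset.sum_range_sub]
  congr 1
  refine Finset.sum_congr rfl fun i hi => ?_
  have hiN : i < N := (Finset.mem_range.1 hi).trans (Finset.mem_range.1 hj)
  rw [dif_pos hiN, h]

theorem extend_zero (x : C(I, ℝ)₀) : extend x 0 = 0 :=
  (extend_coe x 0).trans (map_zero x)

theorem incrementSum_increments (N : ℕ) (x : C(I, ℝ)₀) :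
    incrementSum N (increments N x) =
      (∑ j ∈ Finset.range N, Real.exp (extend x ((j : ℝ) / N))) / N := by
  rw [incrementSum_of_telescope N _ (fun j => extend x (j / N)) fun i => by
    simp [increments]]
  simp [extend_zero]

theorem incrementSum_revIncrements (N : ℕ) (x : C(I, ℝ)₀) :
    incrementSum N (revIncrements N x) =
      (∑ j ∈ Finset.range N, Real.exp (extend x (((j : ℝ) + 1) / N) - extend x 1)) / N := by
  rcases Nat.eq_zero_or_pos N with rfl | hN
  · simp [incrementSum]
  -- The reversed increments are those of j ↦ x((N - j)/N), which starts at x(1). Reflecting the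
  -- summation index produces the right endpoints (j + 1)/N.
  rw [incrementSum_of_telescope N _ (fun j => extend x (((N - j : ℕ) : ℝ) / N)) fun i => ?_,
    ← Finset.sum_range_reflect]
  · congr 1
    refine Finset.sum_congr rfl fun j hj => ?_
    have hj' := Finset.mem_range.1 hj
    have e : N - (N - 1 - j) = j + 1 := by omega
    have hN' : (N : ℝ) ≠ 0 := by exact_mod_cast hN.ne'
    simp only [e, Nat.sub_zero, div_self hN', Nat.cast_add, Nat.cast_one]
  · have e : N - (i : ℕ) = N - (i + 1) + 1 := by omega
    simp only [revIncrements, increments, Fin.val_rev, neg_sub]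
    rw [e]
    push_cast
    ring_nf

theorem tendsto_incrementSum (x : C(I, ℝ)₀) :
    Tendsto (fun N => incrementSum N (increments N x)) atTop (𝓝 (expInt x)) := by
  simp only [incrementSum_increments]
  refine tendsto_riemannSum (continuous_exp_extend x) (c := fun N j => (j : ℝ) / N)
    fun N j hj => ⟨le_rfl, ?_⟩
  gcongr
  linarith

theorem tendsto_incrementSum_rev (x : C(I, ℝ)₀) :
    Tendsto (fun N => incrementSum N (revIncrements N x)) atTop
      (𝓝 (expInt x * Real.exp (-extend x 1))) := by
  have h := (tendsto_riemannSum (continuous_exp_extend x) (c := fun N j => ((j : ℝ) + 1) / N)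
    fun N j hj => ⟨by gcongr; linarith, le_rfl⟩).mul_const (Real.exp (-extend x 1))
  refine h.congr fun N => ?_
  rw [incrementSum_revIncrements, div_mul_eq_mul_div, Finset.sum_mul]
  congr 1
  refine Finset.sum_congr rfl fun j _ => ?_
  rw [← Real.exp_add, sub_eq_add_neg]

/-- The left side is the integral of e^y for the reversed path y(t) = x(1-t) - x(1). Both integrals
are limits of one function of the increments, evaluated at the forward and at the reversed
increments, which have the same law. Characteristic functions pass to the limit by dominated
convergence. -/
theorem map_expInt_rev :
    wienerMeasure.map (fun x => expInt x * Real.exp (-extend x 1)) = wienerMeasure.map expInt := by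
  have hm1 : Measurable expInt := continuous_expInt.measurable
  have hm2 : Measurable fun x => expInt x * Real.exp (-extend x 1) :=
    hm1.mul (measurable_extend 1).neg.exp
  have hinc : ∀ N, Measurable (increments N) := fun N =>
    measurable_pi_lambda _ fun i => measurable_increments N i
  have hrev : ∀ N, Measurable (revIncrements N) := fun N =>
    measurable_pi_lambda _ fun i => (measurable_increments N i.rev).neg
  have hp1 := Measure.isProbabilityMeasure_map (μ := wienerMeasure) hm1.aemeasurable
  have hp2 := Measure.isProbabilityMeasure_map (μ := wienerMeasure) hm2.aemeasurable
  refine Measure.ext_of_charFun (funext fun ξ => ?_)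
  have hψ : Continuous fun y : ℝ => Complex.exp (ξ * y * Complex.I) := by fun_prop
  have lim : ∀ (S : ℕ → C(I, ℝ)₀ → ℝ) (L : C(I, ℝ)₀ → ℝ), (∀ N, Measurable (S N)) →
      (∀ x, Tendsto (fun N => S N x) atTop (𝓝 (L x))) →
      Tendsto (fun N => ∫ x, Complex.exp (ξ * S N x * Complex.I) ∂wienerMeasure) atTop
        (𝓝 (∫ x, Complex.exp (ξ * L x * Complex.I) ∂wienerMeasure)) := by
    intro S L hS hL
    refine tendsto_integral_of_dominated_convergence (fun _ => 1) (fun N => ?_)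
      (integrable_const _) (fun N => ae_of_all _ fun x => ?_) (ae_of_all _ fun x => ?_)
    · exact (hψ.measurable.comp (hS N)).aestronglyMeasurable
    · rw [← Complex.ofReal_mul, Complex.norm_exp_ofReal_mul_I]
    · exact (hψ.tendsto _).comp (hL x)
  have l1 := lim (fun N x => incrementSum N (increments N x)) expInt
    (fun N => (measurable_incrementSum N).comp (hinc N)) tendsto_incrementSum
  have l2 := lim (fun N x => incrementSum N (revIncrements N x)) _
    (fun N => (measurable_incrementSum N).comp (hrev N)) tendsto_incrementSum_rev
  have heq : ∀ N, ∫ x, Complex.exp (ξ * incrementSum N (increments N x) * Complex.I)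
      ∂wienerMeasure =
      ∫ x, Complex.exp (ξ * incrementSum N (revIncrements N x) * Complex.I) ∂wienerMeasure := by
    intro N
    have hme : Measurable fun z : Fin N → ℝ => Complex.exp (ξ * incrementSum N z * Complex.I) :=
      hψ.measurable.comp (measurable_incrementSum N)
    rw [← integral_map (hinc N).aemeasurable hme.aestronglyMeasurable,
      ← map_revIncrements, integral_map (hrev N).aemeasurable hme.aestronglyMeasurable]
  simp only [heq] at l1
  rw [charFun_apply_real, charFun_apply_real,
    integral_map hm1.aemeasurable hψ.aestronglyMeasurable,
    integral_map hm2.aemeasurable hψ.aestronglyMeasurable]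
  exact tendsto_nhds_unique l2 l1

/-- As x(0) = 0, the density is 1/Z at 0 and 1/(Z e^(-x(1))) at 1: the same function of two
variables with equal law. -/
theorem integral_density_zero_pow (l : ℕ) :
    ∫ x, density x 0 ^ l ∂wienerMeasure = ∫ x, density x 1 ^ l ∂wienerMeasure := by
  have hme : AEStronglyMeasurable (fun y : ℝ => y⁻¹ ^ l) (wienerMeasure.map expInt) :=
    Measurable.aestronglyMeasurable (by fun_prop)
  have hme' : AEStronglyMeasurable (fun y : ℝ => y⁻¹ ^ l)
      (wienerMeasure.map fun x => expInt x * Real.exp (-extend x 1)) :=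
    Measurable.aestronglyMeasurable (by fun_prop)
  have h1 := integral_map (μ := wienerMeasure) continuous_expInt.measurable.aemeasurable hme
  have h2 := integral_map (μ := wienerMeasure) (continuous_expInt.measurable.mul
    (measurable_extend 1).neg.exp).aemeasurable hme'
  refine Eq.trans (integral_congr_ae (ae_of_all _ fun x => ?_)) (h1.symm.trans ?_)
  · simp [density, extend_zero]
  · rw [← map_expInt_rev]
    refine h2.trans (integral_congr_ae (ae_of_all _ fun x => ?_))
    simp [density, Real.exp_neg, mul_comm]

/-! ### Bounds by C_g on the coefficients coming from g. -/

section Coefficients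

variable (g : DiffPlus 3)

theorem DiffPlus.der_one_ne_zero_of_three {t : ℝ} (ht : t ∈ Set.Icc (0 : ℝ) 1) :
    g.der 1 t ≠ 0 :=
  DiffPlus.der_one_ne_zero ⟨g.1, g.2.1.of_le (by norm_num), g.2.2.1.of_le (by norm_num), g.2.2.2⟩
    ⟨t, ht⟩

theorem DiffPlus.continuousOn_der {k : ℕ} (hk : k ≤ 3) : ContinuousOn (g.der k) (Set.Icc 0 1) :=
  g.2.1.continuousOn_iteratedDerivWithin (by exact_mod_cast hk) (uniqueDiffOn_Icc zero_lt_one)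

theorem DiffPlus.hasDerivWithinAt_der {k : ℕ} (hk : k < 3) {t : ℝ}
    (ht : t ∈ Set.Icc (0 : ℝ) 1) :
    HasDerivWithinAt (g.der k) (g.der (k + 1) t) (Set.Icc 0 1) t := by
  have h := g.2.1.differentiableOn_iteratedDerivWithin (m := k) (by exact_mod_cast hk)
    (uniqueDiffOn_Icc zero_lt_one) t ht
  have h2 := h.hasDerivWithinAt
  rw [← iteratedDerivWithin_succ] at h2
  exact h2

theorem coeff_sum_le_constC {t : ℝ} (ht : t ∈ Set.Icc (0 : ℝ) 1) :
    |g.der 2 t / g.der 1 t| + |(g.der 2 t / g.der 1 t) ^ 2| + |g.der 3 t / g.der 1 t| ≤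
      constC g - 1 := by
  have hc : ContinuousOn (fun t => |g.der 2 t / g.der 1 t| + |(g.der 2 t / g.der 1 t) ^ 2| +
      |g.der 3 t / g.der 1 t|) (Set.Icc 0 1) := by
    have h1 := g.continuousOn_der (k := 1) (by norm_num)
    have h2 := g.continuousOn_der (k := 2) (by norm_num)
    have h3 := g.continuousOn_der (k := 3) (by norm_num)
    have h0 : ∀ t ∈ Set.Icc (0 : ℝ) 1, g.der 1 t ≠ 0 := fun t ht => g.der_one_ne_zero_of_three ht
    exact (((h2.div h1 h0).abs).add ((h2.div h1 h0).pow 2).abs).add (h3.div h1 h0).abs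
  have hc' := hc.comp_continuous (continuous_subtype_val (p := (· ∈ Set.Icc (0 : ℝ) 1)))
    fun t => t.2
  -- Boundedness is essential: a real `⨆` over an unbounded range is 0. Continuity on the compact
  -- interval supplies it.
  have h := le_ciSup (isCompact_range hc').bddAbove ⟨t, ht⟩
  rw [constC, add_sub_cancel_left]
  exact h

theorem one_le_constC : 1 ≤ constC g := by
  have h := coeff_sum_le_constC g (t := 0) (by simp)
  have : 0 ≤ |g.der 2 0 / g.der 1 0| + |(g.der 2 0 / g.der 1 0) ^ 2| + |g.der 3 0 / g.der 1 0| := by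
    positivity
  linarith

theorem abs_ratio_le {t : ℝ} (ht : t ∈ Set.Icc (0 : ℝ) 1) :
    |g.der 2 t / g.der 1 t| ≤ constC g := by
  have h := coeff_sum_le_constC g ht
  have h1 := abs_nonneg ((g.der 2 t / g.der 1 t) ^ 2)
  have h2 := abs_nonneg (g.der 3 t / g.der 1 t)
  linarith

/-- The derivative of g''/g' is g'''/g' - (g''/g')², bounded by C_g, and the mean value inequality
applies. -/
theorem abs_ratio_sub_le {s t : ℝ} (hs : s ∈ Set.Icc (0 : ℝ) 1) (ht : t ∈ Set.Icc (0 : ℝ) 1) :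
    |g.der 2 t / g.der 1 t - g.der 2 s / g.der 1 s| ≤ constC g * |t - s| := by
  refine (convex_Icc (0 : ℝ) 1).norm_image_sub_le_of_norm_hasDerivWithin_le
    (f := fun t => g.der 2 t / g.der 1 t) (fun u hu => (g.hasDerivWithinAt_der (k := 2)
      (by norm_num) hu).div (g.hasDerivWithinAt_der (k := 1) (by norm_num) hu)
      (g.der_one_ne_zero_of_three hu)) (fun u hu => ?_) hs ht
  have h0 := g.der_one_ne_zero_of_three hu
  have e : (g.der 3 u * g.der 1 u - g.der 2 u * g.der 2 u) / g.der 1 u ^ 2 =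
      g.der 3 u / g.der 1 u - (g.der 2 u / g.der 1 u) ^ 2 := by
    field_simp
  have h := coeff_sum_le_constC g hu
  have h1 := abs_nonneg (g.der 2 u / g.der 1 u)
  refine (le_of_eq (congrArg abs e)).trans ((abs_sub _ _).trans ?_)
  linarith

theorem abs_schwarzian_le {t : ℝ} (ht : t ∈ Set.Icc (0 : ℝ) 1) :
    |schwarzian g t| ≤ 3 / 2 * constC g := by
  have h := coeff_sum_le_constC g ht
  have h1 := abs_nonneg (g.der 2 t / g.der 1 t)
  have h2 := abs_nonneg (g.der 3 t / g.der 1 t)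
  refine (abs_sub _ _).trans ?_
  rw [abs_mul, abs_of_pos (by norm_num : (0 : ℝ) < 3 / 2)]
  linarith

theorem continuousOn_schwarzian : ContinuousOn (schwarzian g) (Set.Icc 0 1) := by
  have h1 := g.continuousOn_der (k := 1) (by norm_num)
  have h2 := g.continuousOn_der (k := 2) (by norm_num)
  have h3 := g.continuousOn_der (k := 3) (by norm_num)
  have h0 : ∀ t ∈ Set.Icc (0 : ℝ) 1, g.der 1 t ≠ 0 := fun t ht => g.der_one_ne_zero_of_three ht
  exact (h3.div h1 h0).sub (((h2.div h1 h0).pow 2).const_mul _)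

end Coefficients

/-! ### Measurability and size of the Schwarzian integral. -/

theorem DiffPlus.fn_mem {r : ℕ} (q : DiffPlus r) (t : ℝ) : q.fn t ∈ Set.Icc (0 : ℝ) 1 :=
  (q.1 (Set.projIcc 0 1 zero_le_one t)).2

theorem DiffPlus.continuous_fn {r : ℕ} (q : DiffPlus r) : Continuous q.fn := by
  have h : Continuous fun t : I => (q.1 t : ℝ) := by fun_prop
  exact h.Icc_extend'

theorem DiffPlus.measurable_fn (t : ℝ) : Measurable fun q : DiffPlus 1 => q.fn t :=
  ((continuous_eval_const (Set.projIcc 0 1 zero_le_one t)).comp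
    DiffPlus.continuous_val).measurable

/-- The derivative of `q`, extended to the real line by constants. -/
noncomputable def DiffPlus.derExt (q : DiffPlus 1) : ℝ → ℝ :=
  Set.IccExtend (zero_le_one' ℝ) q.derMap

theorem DiffPlus.continuous_derExt (q : DiffPlus 1) : Continuous q.derExt :=
  q.derMap.continuous.Icc_extend'

theorem DiffPlus.measurable_derExt (t : ℝ) : Measurable fun q : DiffPlus 1 => q.derExt t :=
  (DiffPlus.continuous_eval_der (Set.projIcc 0 1 zero_le_one t)).measurable

theorem DiffPlus.derExt_of_mem (q : DiffPlus 1) {t : ℝ} (ht : t ∈ Set.Icc (0 : ℝ) 1) :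
    q.derExt t = q.der 1 t :=
  Set.IccExtend_of_mem _ _ ht

theorem DiffPlus.intervalIntegrable_der_sq (q : DiffPlus 1) :
    IntervalIntegrable (fun t => q.der 1 t ^ 2) volume 0 1 := by
  have h : ContinuousOn (q.der 1) (Set.Icc 0 1) :=
    q.2.1.continuousOn_iteratedDerivWithin le_rfl (uniqueDiffOn_Icc zero_lt_one)
  refine ContinuousOn.intervalIntegrable ?_
  rw [Set.uIcc_of_le zero_le_one]
  exact h.pow 2

/-- An integrand continuous in time and measurable in the parameter is jointly measurable. -/
theorem measurable_intervalIntegral_of_continuous {α : Type*} [MeasurableSpace α]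
    {u : α → ℝ → ℝ} {a b : ℝ} (hab : a ≤ b) (hc : ∀ q, Continuous (u q))
    (hm : ∀ t, Measurable fun q => u q t) : Measurable fun q => ∫ t in a..b, u q t := by
  have h : Measurable (Function.uncurry fun (t : ℝ) (q : α) => u q t) :=
    measurable_uncurry_of_continuous_of_measurable hc hm
  have h' : Measurable (Function.uncurry u) := h.comp measurable_swap
  simp only [intervalIntegral.integral_of_le hab]
  exact h'.stronglyMeasurable.integral_prod_right.measurable

theorem measurable_schwarzian_integral (g : DiffPlus 3) {a l : ℝ} (ha : 0 ≤ a) (hl : 0 ≤ l)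
    (hal : a + l ≤ 1) : Measurable fun q : DiffPlus 1 =>
      ∫ t in (0 : ℝ)..1, schwarzian g (a + l * q.fn t) * q.der 1 t ^ 2 := by
  -- Constant extensions of the Schwarzian and of q' are continuous on all of ℝ and do not change
  -- the integral.
  set S : ℝ → ℝ := Set.IccExtend (zero_le_one' ℝ) ((Set.Icc 0 1).domRestrict (schwarzian g)) with hS
  have hSc : Continuous S := (continuousOn_schwarzian g).domRestrict.Icc_extend'
  have e : ∀ q : DiffPlus 1, ∫ t in (0 : ℝ)..1, schwarzian g (a + l * q.fn t) * q.der 1 t ^ 2 =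
      ∫ t in (0 : ℝ)..1, S (a + l * q.fn t) * q.derExt t ^ 2 := by
    intro q
    refine intervalIntegral.integral_congr fun t ht => ?_
    rw [Set.uIcc_of_le zero_le_one] at ht
    have hm := q.fn_mem t
    have hm' : a + l * q.fn t ∈ Set.Icc (0 : ℝ) 1 :=
      ⟨by have := hm.1; positivity, by nlinarith [hm.2]⟩
    simp only [q.derExt_of_mem ht, hS]
    rw [Set.IccExtend_of_mem _ _ hm', Set.domRestrict_apply]
  simp only [e]
  refine measurable_intervalIntegral_of_continuous zero_le_one (fun q => ?_) fun t => ?_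
  · exact (hSc.comp (continuous_const.add (continuous_const.mul q.continuous_fn))).mul
      (q.continuous_derExt.pow 2)
  · exact (hSc.measurable.comp (measurable_const.add
      ((DiffPlus.measurable_fn t).const_mul l))).mul ((DiffPlus.measurable_derExt t).pow_const 2)

theorem abs_schwarzian_integral_le (g : DiffPlus 3) (q : DiffPlus 1) {a l : ℝ} (ha : 0 ≤ a)
    (hl : 0 ≤ l) (hal : a + l ≤ 1) :
    |∫ t in (0 : ℝ)..1, schwarzian g (a + l * q.fn t) * q.der 1 t ^ 2| ≤
      3 / 2 * constC g * ∫ t in (0 : ℝ)..1, q.der 1 t ^ 2 := by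
  rw [← intervalIntegral.integral_const_mul, ← Real.norm_eq_abs]
  refine intervalIntegral.norm_integral_le_of_norm_le zero_le_one (ae_of_all _ fun t _ => ?_)
    (q.intervalIntegrable_der_sq.const_mul _)
  have hm := q.fn_mem t
  have hm' : a + l * q.fn t ∈ Set.Icc (0 : ℝ) 1 :=
    ⟨by have := hm.1; positivity, by nlinarith [hm.2]⟩
  rw [Real.norm_eq_abs, abs_mul, abs_of_nonneg (sq_nonneg (q.der 1 t))]
  gcongr
  exact abs_schwarzian_le g hm'

/-! ### Moments on E_δ. -/

section Moments

variable {δ : ℝ}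

theorem measurable_holder {f : DiffPlus 1 → ℝ} (hf : Measurable f) :
    Measurable fun q : DiffHolder δ => f q.1 :=
  hf.comp (measurableEmbedding_toDiffPlus δ).measurable

theorem measurable_der {t : ℝ} (ht : t ∈ Set.Icc (0 : ℝ) 1) :
    Measurable fun q : DiffHolder δ => q.1.der 1 t :=
  measurable_holder (DiffPlus.continuous_eval_der ⟨t, ht⟩).measurable

theorem memLp_der (hδ0 : 0 < δ) (hδ : δ < 1 / 2) {t : ℝ} (ht : t ∈ Set.Icc (0 : ℝ) 1) :
    MemLp (fun q : DiffHolder δ => q.1.der 1 t) 2 (nuHolder δ) := by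
  rw [memLp_two_iff_integrable_sq (measurable_der ht).aestronglyMeasurable,
    integrable_nuHolder hδ0 hδ fun q => q.der 1 t ^ 2]
  simp only [der_ofPath_eq_density _ ht]
  exact (memLp_density ht).integrable_sq

theorem integrable_integral_der_sq (hδ0 : 0 < δ) (hδ : δ < 1 / 2) :
    Integrable (fun q : DiffHolder δ => ∫ t in (0 : ℝ)..1, q.1.der 1 t ^ 2) (nuHolder δ) := by
  rw [integrable_nuHolder hδ0 hδ fun q => ∫ t in (0 : ℝ)..1, q.der 1 t ^ 2]
  refine integrable_integral_density_sq.congr (ae_of_all _ fun x => ?_)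
  refine intervalIntegral.integral_congr fun t ht => ?_
  rw [Set.uIcc_of_le zero_le_one] at ht
  simp only [der_ofPath_eq_density _ ht]

theorem integral_der_zero_pow (hδ0 : 0 < δ) (hδ : δ < 1 / 2) (l : ℕ) :
    ∫ q : DiffHolder δ, q.1.der 1 0 ^ l ∂nuHolder δ = moment δ l := by
  rw [moment, integral_nuHolder hδ0 hδ fun q => q.der 1 0 ^ l,
    integral_nuHolder hδ0 hδ fun q => q.der 1 1 ^ l]
  simp only [der_ofPath_eq_density _ (Set.left_mem_Icc.2 zero_le_one),
    der_ofPath_eq_density _ (Set.right_mem_Icc.2 zero_le_one)]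
  exact integral_density_zero_pow l

theorem moment_nonneg (l : ℕ) : 0 ≤ moment δ l :=
  integral_nonneg fun q => pow_nonneg (q.1.der_one_pos 1).le l

theorem integral_integral_der_sq_nonneg :
    0 ≤ ∫ q : DiffHolder δ, (∫ t in (0 : ℝ)..1, q.1.der 1 t ^ 2) ∂nuHolder δ :=
  integral_nonneg fun _ => intervalIntegral.integral_nonneg zero_le_one fun _ _ => sq_nonneg _

end Moments

/-! ### Estimates for one interval of the partition. -/

section Partition

variable {n : ℕ} {x : Fin (n + 1) → ℝ}

theorem mem_Icc_of_partition (hx : x ∈ partitions n) (i : Fin (n + 1)) :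
    x i ∈ Set.Icc (0 : ℝ) 1 :=
  ⟨hx.1 ▸ hx.2.2.monotone (Fin.zero_le i), hx.2.1 ▸ hx.2.2.monotone (Fin.le_last i)⟩

theorem gap_pos (hx : x ∈ partitions n) (k : Fin n) : 0 < gap x k :=
  sub_pos.2 (hx.2.2 Fin.castSucc_lt_succ)

theorem gap_le_mesh (x : Fin (n + 1) → ℝ) (k : Fin n) : gap x k ≤ mesh x :=
  le_ciSup (Set.finite_range (gap x)).bddAbove k

theorem sum_gap (hx : x ∈ partitions n) : ∑ k, gap x k = 1 := by
  have h := (Fin.sum_univ_succ x).symm.trans (Fin.sum_univ_castSucc x)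
  rw [hx.1, hx.2.1] at h
  simp only [gap, Finset.sum_sub_distrib]
  linarith

theorem castSucc_add_gap (x : Fin (n + 1) → ℝ) (k : Fin n) :
    x k.castSucc + gap x k = x k.succ := by
  unfold gap; ring

end Partition

/-- The function of a single diffeomorphism underlying `termX`. -/
noncomputable def summandX {δ : ℝ} {n : ℕ} (g : DiffPlus 3) (x : Fin (n + 1) → ℝ) (k : Fin n)
    (p : DiffHolder δ) : ℝ :=
  gap x k * (g.der 2 (x k.castSucc) / g.der 1 (x k.castSucc) * p.1.der 1 0 -
    g.der 2 (x k.succ) / g.der 1 (x k.succ) * p.1.der 1 1)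

/-- The function of a single diffeomorphism underlying `termY`. -/
noncomputable def summandY {δ : ℝ} {n : ℕ} (g : DiffPlus 3) (x : Fin (n + 1) → ℝ) (k : Fin n)
    (p : DiffHolder δ) : ℝ :=
  gap x k ^ 2 * ∫ t in (0 : ℝ)..1,
    schwarzian g (x k.castSucc + gap x k * p.1.fn t) * p.1.der 1 t ^ 2

section Summands

variable {δ : ℝ} {n : ℕ} {x : Fin (n + 1) → ℝ} (g : DiffPlus 3)

theorem measurable_summandX (x : Fin (n + 1) → ℝ) (k : Fin n) :
    Measurable (summandX g x k : DiffHolder δ → ℝ) :=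
  (((measurable_der (by simp)).const_mul _).sub ((measurable_der (by simp)).const_mul _)).const_mul _

theorem measurable_summandY (hx : x ∈ partitions n) (k : Fin n) :
    Measurable (summandY g x k : DiffHolder δ → ℝ) := by
  refine Measurable.const_mul (measurable_holder (measurable_schwarzian_integral g
    (mem_Icc_of_partition hx _).1 (gap_pos hx k).le ?_)) _
  rw [castSucc_add_gap]
  exact (mem_Icc_of_partition hx _).2

theorem memLp_summandX (hδ0 : 0 < δ) (hδ : δ < 1 / 2) (x : Fin (n + 1) → ℝ) (k : Fin n) :
    MemLp (summandX g x k) 2 (nuHolder δ) :=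
  (((memLp_der hδ0 hδ (by simp)).const_mul _).sub
    ((memLp_der hδ0 hδ (by simp)).const_mul _)).const_mul _

/-- Since q'(0) and q'(1) both have mean M₁, only the difference of g''/g' across the interval
survives. It contributes a second factor of the gap, which is then bounded by the mesh. -/
theorem abs_integral_summandX_le (hδ0 : 0 < δ) (hδ : δ < 1 / 2) (hx : x ∈ partitions n)
    (k : Fin n) :
    |∫ p, summandX g x k p ∂nuHolder δ| ≤ gap x k * (mesh x * (constC g * moment δ 1)) := by
  have := isProbabilityMeasure_nuHolder hδ0 hδ
  have h0 : Integrable (fun p : DiffHolder δ => p.1.der 1 0) (nuHolder δ) :=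
    (memLp_der hδ0 hδ (by simp)).integrable (by norm_num)
  have h1 : Integrable (fun p : DiffHolder δ => p.1.der 1 1) (nuHolder δ) :=
    (memLp_der hδ0 hδ (by simp)).integrable (by norm_num)
  have e0 : ∫ p : DiffHolder δ, p.1.der 1 0 ∂nuHolder δ = moment δ 1 := by
    simpa using integral_der_zero_pow hδ0 hδ 1
  have e1 : ∫ p : DiffHolder δ, p.1.der 1 1 ∂nuHolder δ = moment δ 1 := by simp [moment]
  have hg := gap_pos hx k
  have e : ∫ p, summandX g x k p ∂nuHolder δ = gap x k *
      ((g.der 2 (x k.castSucc) / g.der 1 (x k.castSucc) -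
        g.der 2 (x k.succ) / g.der 1 (x k.succ)) * moment δ 1) := by
    simp only [summandX]
    rw [integral_const_mul, integral_sub (h0.const_mul _) (h1.const_mul _), integral_const_mul,
      integral_const_mul, e0, e1]
    ring
  rw [e, abs_mul, abs_of_pos hg, abs_mul, abs_of_nonneg (moment_nonneg 1)]
  refine mul_le_mul_of_nonneg_left ?_ hg.le
  have h := abs_ratio_sub_le g (mem_Icc_of_partition hx k.castSucc) (mem_Icc_of_partition hx k.succ)
  rw [abs_sub_comm] at h
  rw [← mul_assoc, mul_comm (mesh x)]
  refine mul_le_mul_of_nonneg_right (h.trans ?_) (moment_nonneg 1)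
  refine mul_le_mul_of_nonneg_left ?_ (zero_le_one.trans (one_le_constC g))
  exact (abs_of_pos hg).trans_le (gap_le_mesh x k)

theorem integral_summandX_sq_le (hδ0 : 0 < δ) (hδ : δ < 1 / 2) (hx : x ∈ partitions n)
    (k : Fin n) :
    ∫ p, summandX g x k p ^ 2 ∂nuHolder δ ≤
      gap x k * (mesh x * (4 * constC g ^ 2 * moment δ 2)) := by
  have h0 : Integrable (fun p : DiffHolder δ => p.1.der 1 0 ^ 2) (nuHolder δ) :=
    (memLp_der hδ0 hδ (by simp)).integrable_sq
  have h1 : Integrable (fun p : DiffHolder δ => p.1.der 1 1 ^ 2) (nuHolder δ) :=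
    (memLp_der hδ0 hδ (by simp)).integrable_sq
  have hC := one_le_constC g
  have hg := gap_pos hx k
  have hpt : ∀ p : DiffHolder δ, summandX g x k p ^ 2 ≤
      gap x k ^ 2 * (2 * constC g ^ 2) * (p.1.der 1 0 ^ 2 + p.1.der 1 1 ^ 2) := by
    intro p
    have ha := sq_le_sq' (abs_le.1 (abs_ratio_le g (mem_Icc_of_partition hx k.castSucc))).1
      (abs_le.1 (abs_ratio_le g (mem_Icc_of_partition hx k.castSucc))).2
    have hb := sq_le_sq' (abs_le.1 (abs_ratio_le g (mem_Icc_of_partition hx k.succ))).1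
      (abs_le.1 (abs_ratio_le g (mem_Icc_of_partition hx k.succ))).2
    rw [summandX, mul_pow, mul_assoc]
    generalize g.der 2 (x k.castSucc) / g.der 1 (x k.castSucc) = a at *
    generalize g.der 2 (x k.succ) / g.der 1 (x k.succ) = b at *
    refine mul_le_mul_of_nonneg_left ?_ (sq_nonneg _)
    -- (u - v)² ≤ 2u² + 2v². After integration both squares give M₂, hence the constant 4.
    calc _ ≤ 2 * (a ^ 2 * p.1.der 1 0 ^ 2 + b ^ 2 * p.1.der 1 1 ^ 2) := by
          nlinarith [sq_nonneg (a * p.1.der 1 0 + b * p.1.der 1 1)]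
      _ ≤ 2 * (constC g ^ 2 * p.1.der 1 0 ^ 2 + constC g ^ 2 * p.1.der 1 1 ^ 2) := by gcongr
      _ = _ := by ring
  have e1 : ∫ p : DiffHolder δ, p.1.der 1 1 ^ 2 ∂nuHolder δ = moment δ 2 := rfl
  calc _ ≤ ∫ p : DiffHolder δ, gap x k ^ 2 * (2 * constC g ^ 2) *
        (p.1.der 1 0 ^ 2 + p.1.der 1 1 ^ 2) ∂nuHolder δ :=
        integral_mono (memLp_summandX g hδ0 hδ x k).integrable_sq ((h0.add h1).const_mul _) hpt
    _ = gap x k * (gap x k * (4 * constC g ^ 2 * moment δ 2)) := by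
        rw [integral_const_mul, integral_add h0 h1, integral_der_zero_pow hδ0 hδ 2, e1]
        ring
    _ ≤ _ := by
        have := moment_nonneg (δ := δ) 2
        have := gap_le_mesh x k
        gcongr

theorem abs_summandY_le (hx : x ∈ partitions n) (k : Fin n) (p : DiffHolder δ) :
    |summandY g x k p| ≤
      gap x k ^ 2 * (3 / 2 * constC g * ∫ t in (0 : ℝ)..1, p.1.der 1 t ^ 2) := by
  rw [summandY, abs_mul, abs_of_nonneg (sq_nonneg (gap x k))]
  refine mul_le_mul_of_nonneg_left (abs_schwarzian_integral_le g p.1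
    (mem_Icc_of_partition hx _).1 (gap_pos hx k).le ?_) (sq_nonneg _)
  rw [castSucc_add_gap]
  exact (mem_Icc_of_partition hx _).2

theorem integrable_summandY (hδ0 : 0 < δ) (hδ : δ < 1 / 2) (hx : x ∈ partitions n) (k : Fin n) :
    Integrable (summandY g x k) (nuHolder δ) :=
  (((integrable_integral_der_sq hδ0 hδ).const_mul _).const_mul _).mono'
    (measurable_summandY g hx k).aestronglyMeasurable (ae_of_all _ (abs_summandY_le g hx k))

theorem integral_abs_summandY_le (hδ0 : 0 < δ) (hδ : δ < 1 / 2) (hx : x ∈ partitions n)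
    (k : Fin n) :
    ∫ p, |summandY g x k p| ∂nuHolder δ ≤ gap x k * (mesh x * (3 / 2 * constC g *
      ∫ q : DiffHolder δ, (∫ t in (0 : ℝ)..1, q.1.der 1 t ^ 2) ∂nuHolder δ)) := by
  have hC := one_le_constC g
  have hJ := integral_integral_der_sq_nonneg (δ := δ)
  have hg := gap_pos hx k
  have hm := gap_le_mesh x k
  refine (integral_mono (integrable_summandY g hδ0 hδ hx k).abs
    (((integrable_integral_der_sq hδ0 hδ).const_mul _).const_mul _)
    (abs_summandY_le g hx k)).trans ?_
  rw [integral_const_mul, integral_const_mul, sq, mul_assoc]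
  gcongr

end Summands

/-! ### The sums f₁ and f₂: mean, variance and tail bounds. -/

section Sums

variable {δ : ℝ} {n : ℕ} {x : Fin (n + 1) → ℝ} (g : DiffPlus 3)

theorem isProbabilityMeasure_nuProd (hδ0 : 0 < δ) (hδ : δ < 1 / 2) :
    IsProbabilityMeasure (nuProd δ n) := by
  have := isProbabilityMeasure_nuHolder hδ0 hδ
  unfold nuProd
  infer_instance

theorem f1_eq (x : Fin (n + 1) → ℝ) :
    (f1 g x : (Fin n → DiffHolder δ) → ℝ) = ∑ k, fun q => summandX g x k (q k) := by
  funext q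
  rw [Finset.sum_apply]
  rfl

theorem measurable_f1 (x : Fin (n + 1) → ℝ) :
    Measurable (f1 g x : (Fin n → DiffHolder δ) → ℝ) :=
  Finset.measurable_fun_sum _ fun k _ =>
    (measurable_summandX g x k).comp (measurable_pi_apply k)

theorem measurable_f2 (hx : x ∈ partitions n) :
    Measurable (f2 g x : (Fin n → DiffHolder δ) → ℝ) :=
  Finset.measurable_fun_sum _ fun k _ => (measurable_summandY g hx k).comp (measurable_pi_apply k)

theorem measurePreserving_eval_nuProd (hδ0 : 0 < δ) (hδ : δ < 1 / 2) (k : Fin n) :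
    MeasurePreserving (Function.eval k) (nuProd δ n) (nuHolder δ) := by
  have := isProbabilityMeasure_nuHolder hδ0 hδ
  exact measurePreserving_eval (fun _ : Fin n => nuHolder δ) k

theorem integral_eval_nuProd (hδ0 : 0 < δ) (hδ : δ < 1 / 2) (k : Fin n) {f : DiffHolder δ → ℝ}
    (hf : AEStronglyMeasurable f (nuHolder δ)) :
    ∫ q, f (q k) ∂nuProd δ n = ∫ p, f p ∂nuHolder δ := by
  have := isProbabilityMeasure_nuHolder hδ0 hδ
  exact integral_comp_eval (μ := fun _ : Fin n => nuHolder δ) hf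

theorem memLp_termX (hδ0 : 0 < δ) (hδ : δ < 1 / 2) (x : Fin (n + 1) → ℝ) (k : Fin n) :
    MemLp (fun q => summandX g x k (q k)) 2 (nuProd δ n) :=
  (memLp_summandX g hδ0 hδ x k).comp_measurePreserving (measurePreserving_eval_nuProd hδ0 hδ k)

theorem memLp_f1 (hδ0 : 0 < δ) (hδ : δ < 1 / 2) (x : Fin (n + 1) → ℝ) :
    MemLp (f1 g x) 2 (nuProd δ n) := by
  rw [f1_eq]
  exact memLp_finsetSum' _ fun k _ => memLp_termX g hδ0 hδ x k

theorem abs_integral_f1_le (hδ0 : 0 < δ) (hδ : δ < 1 / 2) (hx : x ∈ partitions n) :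
    |∫ q, f1 g x q ∂nuProd δ n| ≤ mesh x * (constC g * moment δ 1) := by
  have := isProbabilityMeasure_nuProd (n := n) hδ0 hδ
  simp only [f1_eq, Finset.sum_apply]
  rw [integral_finsetSum _ fun k _ => (memLp_termX g hδ0 hδ x k).integrable (by norm_num)]
  refine (Finset.abs_sum_le_sum_abs _ _).trans ((Finset.sum_le_sum
    (g := fun k => gap x k * (mesh x * (constC g * moment δ 1))) fun k _ => ?_).trans_eq ?_)
  · rw [integral_eval_nuProd hδ0 hδ k (measurable_summandX g x k).aestronglyMeasurable]
    exact abs_integral_summandX_le g hδ0 hδ hx k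
  · rw [← Finset.sum_mul, sum_gap hx, one_mul]

/-- Under the product measure the X_k are independent, so variances add. Each is at most a second
moment, of order gap times mesh, and the gaps sum to 1. -/
theorem variance_f1_le (hδ0 : 0 < δ) (hδ : δ < 1 / 2) (hx : x ∈ partitions n) :
    Var[f1 g x; nuProd δ n] ≤ mesh x * (4 * constC g ^ 2 * moment δ 2) := by
  have hp := isProbabilityMeasure_nuHolder hδ0 hδ
  have := isProbabilityMeasure_nuProd (n := n) hδ0 hδ
  have hind : iIndepFun (fun k (q : Fin n → DiffHolder δ) => summandX g x k (q k)) (nuProd δ n) :=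
    iIndepFun_pi (μ := fun _ : Fin n => nuHolder δ) fun k =>
      (measurable_summandX g x k).aemeasurable
  rw [f1_eq, IndepFun.variance_sum (fun k _ => memLp_termX g hδ0 hδ x k)
    fun i _ j _ hij => hind.indepFun hij]
  calc _ ≤ ∑ k, gap x k * (mesh x * (4 * constC g ^ 2 * moment δ 2)) := by
        refine Finset.sum_le_sum fun k _ => ?_
        refine (variance_le_expectation_sq
          (memLp_termX g hδ0 hδ x k).aestronglyMeasurable).trans ?_
        refine le_trans (le_of_eq ?_) (integral_summandX_sq_le g hδ0 hδ hx k)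
        exact integral_eval_nuProd hδ0 hδ k (f := fun p => summandX g x k p ^ 2)
          ((measurable_summandX g x k).pow_const 2).aestronglyMeasurable
    _ = _ := by rw [← Finset.sum_mul, sum_gap hx, one_mul]

theorem integrable_termY (hδ0 : 0 < δ) (hδ : δ < 1 / 2) (hx : x ∈ partitions n) (k : Fin n) :
    Integrable (fun q => summandY g x k (q k)) (nuProd δ n) :=
  (measurePreserving_eval_nuProd hδ0 hδ k).integrable_comp_of_integrable
    (integrable_summandY g hδ0 hδ hx k)

theorem integrable_f2 (hδ0 : 0 < δ) (hδ : δ < 1 / 2) (hx : x ∈ partitions n) :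
    Integrable (f2 g x) (nuProd δ n) :=
  integrable_finsetSum _ fun k _ => integrable_termY g hδ0 hδ hx k

theorem integral_abs_f2_le (hδ0 : 0 < δ) (hδ : δ < 1 / 2) (hx : x ∈ partitions n) :
    ∫ q, |f2 g x q| ∂nuProd δ n ≤ mesh x * (3 / 2 * constC g *
      ∫ q : DiffHolder δ, (∫ t in (0 : ℝ)..1, q.1.der 1 t ^ 2) ∂nuHolder δ) := by
  calc _ ≤ ∫ q, ∑ k, |summandY g x k (q k)| ∂nuProd δ n :=
        integral_mono (integrable_f2 g hδ0 hδ hx).abs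
          (integrable_finsetSum _ fun k _ => (integrable_termY g hδ0 hδ hx k).abs)
          fun q => Finset.abs_sum_le_sum_abs _ _
    _ = ∑ k, ∫ p, |summandY g x k p| ∂nuHolder δ := by
        rw [integral_finsetSum _ fun k _ => (integrable_termY g hδ0 hδ hx k).abs]
        refine Finset.sum_congr rfl fun k _ => ?_
        exact integral_eval_nuProd hδ0 hδ k (f := fun p => |summandY g x k p|)
          (integrable_summandY g hδ0 hδ hx k).abs.aestronglyMeasurable
    _ ≤ ∑ k, gap x k * (mesh x * (3 / 2 * constC g *
        ∫ q : DiffHolder δ, (∫ t in (0 : ℝ)..1, q.1.der 1 t ^ 2) ∂nuHolder δ)) :=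
        Finset.sum_le_sum fun k _ => integral_abs_summandY_le g hδ0 hδ hx k
    _ = _ := by rw [← Finset.sum_mul, sum_gap hx, one_mul]

/-- Chebyshev's inequality: a variance of order ρ³ against a squared threshold of order ρ² leaves ρ.
-/
theorem measure_abs_f1_sub_ge_le (hδ0 : 0 < δ) (hδ : δ < 1 / 2) (hx : x ∈ partitions n)
    {ρ : ℝ} (hρ : 0 < ρ) (hmesh : mesh x ≤ ρ ^ 3) :
    nuProd δ n {q | c4 δ * constC g * ρ ≤ |f1 g x q - ∫ q, f1 g x q ∂nuProd δ n|} ≤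
      ENNReal.ofReal ρ := by
  have := isProbabilityMeasure_nuProd (n := n) hδ0 hδ
  have hC := one_le_constC g
  have h1 := moment_nonneg (δ := δ) 1
  have h2 := moment_nonneg (δ := δ) 2
  have hJ := integral_integral_der_sq_nonneg (δ := δ)
  have hc : 1 + moment δ 2 ≤ c4 δ := by unfold c4; linarith
  have hc0 : 0 < c4 δ := by linarith
  refine (meas_ge_le_variance_div_sq (memLp_f1 g hδ0 hδ x) (by positivity)).trans
    (ENNReal.ofReal_le_ofReal ?_)
  rw [div_le_iff₀ (by positivity)]
  -- 4M₂ ≤ (1 + M₂)² ≤ c₄²; the summand 1 in c₄ is what permits this.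
  have hM : 4 * moment δ 2 ≤ c4 δ ^ 2 := by nlinarith [sq_nonneg (1 - moment δ 2)]
  calc _ ≤ ρ ^ 3 * (4 * constC g ^ 2 * moment δ 2) :=
        (variance_f1_le g hδ0 hδ hx).trans (by gcongr)
    _ = ρ ^ 3 * constC g ^ 2 * (4 * moment δ 2) := by ring
    _ ≤ ρ ^ 3 * constC g ^ 2 * c4 δ ^ 2 := by gcongr
    _ = _ := by ring

/-- Markov's inequality applied to E |f₂|, which is of order ρ³. The threshold factor 2 absorbs the
3/2 of the Schwarzian bound, and ρ³ ≤ ρ² suffices. -/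
theorem measure_abs_f2_ge_le (hδ0 : 0 < δ) (hδ : δ < 1 / 2) (hx : x ∈ partitions n)
    {ρ : ℝ} (hρ : 0 < ρ) (hρ1 : ρ ≤ 1) (hmesh : mesh x ≤ ρ ^ 3) :
    nuProd δ n {q | 2 * (c4 δ * constC g * ρ) ≤ |f2 g x q|} ≤ ENNReal.ofReal ρ := by
  have := isProbabilityMeasure_nuProd (n := n) hδ0 hδ
  have hC := one_le_constC g
  have h1 := moment_nonneg (δ := δ) 1
  have h2 := moment_nonneg (δ := δ) 2
  have hJ := integral_integral_der_sq_nonneg (δ := δ)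
  have hI := integral_abs_f2_le g hδ0 hδ hx
  set J := ∫ q : DiffHolder δ, (∫ t in (0 : ℝ)..1, q.1.der 1 t ^ 2) ∂nuHolder δ with hJdef
  have hc : J ≤ c4 δ := by unfold c4; linarith
  have hc0 : 0 < c4 δ := by unfold c4; linarith
  have hT : 0 < 2 * (c4 δ * constC g * ρ) := by positivity
  have h := mul_meas_ge_le_integral_of_nonneg (ae_of_all _ fun q => abs_nonneg (f2 g x q))
    (integrable_f2 g hδ0 hδ hx).abs (2 * (c4 δ * constC g * ρ))
  rw [← ofReal_measureReal]
  refine ENNReal.ofReal_le_ofReal (le_of_mul_le_mul_left (h.trans (hI.trans ?_)) hT)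
  calc _ ≤ ρ ^ 3 * (3 / 2 * constC g * c4 δ) := by gcongr
    _ ≤ ρ ^ 2 * (2 * constC g * c4 δ) := by
        have : ρ ^ 3 ≤ ρ ^ 2 := pow_le_pow_of_le_one hρ.le hρ1 (by norm_num)
        gcongr
        norm_num
    _ = _ := by ring

theorem measure_abs_add_gt_le (hδ0 : 0 < δ) (hδ : δ < 1 / 2) (hx : x ∈ partitions n)
    {ρ : ℝ} (hρ : 0 < ρ) (hρ1 : ρ ≤ 1) (hmesh : mesh x ≤ ρ ^ 3) :
    nuProd δ n {q | |f1 g x q + f2 g x q| > 4 * c4 δ * constC g * ρ} ≤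
      ENNReal.ofReal (2 * ρ) := by
  have hC := one_le_constC g
  have h1 := moment_nonneg (δ := δ) 1
  have h2 := moment_nonneg (δ := δ) 2
  have hJ := integral_integral_der_sq_nonneg (δ := δ)
  have hc : moment δ 1 ≤ c4 δ := by unfold c4; linarith
  have hE : |∫ q, f1 g x q ∂nuProd δ n| ≤ c4 δ * constC g * ρ := by
    refine (abs_integral_f1_le g hδ0 hδ hx).trans ?_
    calc _ ≤ ρ ^ 3 * (constC g * c4 δ) := by gcongr
      _ ≤ ρ * (constC g * c4 δ) := by
          have hc0 : 0 ≤ c4 δ := h1.trans hc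
          gcongr
          exact pow_le_of_le_one hρ.le hρ1 three_ne_zero
      _ = _ := by ring
  rw [two_mul, ENNReal.ofReal_add hρ.le hρ.le]
  -- The budget 4 splits as 1 for the mean of f₁, 1 for its deviation and 2 for f₂. Exceeding it
  -- forces one of the last two to reach its threshold.
  refine le_trans (measure_mono fun q hq => ?_) ((measure_union_le _ _).trans (add_le_add
    (measure_abs_f1_sub_ge_le g hδ0 hδ hx hρ hmesh)
    (measure_abs_f2_ge_le g hδ0 hδ hx hρ hρ1 hmesh)))
  by_contra hcon
  simp only [Set.mem_union, Set.mem_ofPred_eq, not_or, not_le] at hcon hq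
  have ha := abs_add_le (f1 g x q) (f2 g x q)
  have hb := abs_sub_abs_le_abs_sub (f1 g x q) (∫ q, f1 g x q ∂nuProd δ n)
  linarith [hcon.1, hcon.2]

end Sums

end WienerDiff

theorem mainTheorem7 (δ : ℝ) (hδ0 : 0 < δ) (hδ : δ < 1 / 2)
    (ε : ℝ) (hε : ε ∈ Set.Ioo (0 : ℝ) 1) (g : WienerDiff.DiffPlus 3)
    (n : ℕ) (x : Fin (n + 1) → ℝ) (hx : x ∈ WienerDiff.partitions n)
    (hmesh : WienerDiff.mesh x < ε) :
    IsProbabilityMeasure (WienerDiff.nuProd δ n) ∧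
    Measurable (fun q : Fin n → WienerDiff.DiffHolder δ =>
      WienerDiff.f1 g x q + WienerDiff.f2 g x q) ∧
    WienerDiff.nuProd δ n {q | |WienerDiff.f1 g x q + WienerDiff.f2 g x q| >
        4 * WienerDiff.c4 δ * WienerDiff.constC g * ε ^ (1 / 3 : ℝ)} ≤
      ENNReal.ofReal (2 * ε ^ (1 / 3 : ℝ)) := by
  refine ⟨WienerDiff.isProbabilityMeasure_nuProd hδ0 hδ,
    (WienerDiff.measurable_f1 g x).add (WienerDiff.measurable_f2 g hx),
    WienerDiff.measure_abs_add_gt_le g hδ0 hδ hx (Real.rpow_pos_of_pos hε.1 _)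
      (Real.rpow_le_one hε.1.le hε.2.le (by norm_num)) (hmesh.le.trans_eq ?_)⟩
  -- With ρ = ε^(1/3), the mesh condition reads mesh ≤ ρ³ = ε.
  rw [← Real.rpow_natCast, ← Real.rpow_mul hε.1.le]
  norm_num
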